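/- A set partition of $[n]=\{1,\dots,n\}$ ($n\ge 0$) is represented by its canonical sequential form, i.e. the word $\pi=\pi_1\pi_2\cdots\pi_n$ in which $\pi_j=i$ means that $j$ lies in the $i$-th block, the blocks being ordered by increasing minima; $n$ is the size of $\pi$, and for $n=0$ there is a single, empty partition. A partition $\pi$ contains a partition $\tau$ if the word $\pi$ has a subsequence order-isomorphic to the word $\tau$; otherwise $\pi$ avoids $\tau$. A partition is non-crossing if it avoids $1212$. For partitions $\sigma,\tau$, let $\sigma[\tau]$ denote the partition whose word is $\sigma$ followed by the word obtained from $\tau$ by adding to each symbol the number of distinct symbols of $\sigma$; iterating, one obtains $\sigma_1[\sigma_2]\cdots[\sigma_k]$. A partition is connected if it is not of the form $\sigma[\tau]$ with $\sigma$ and $\tau$ both nonempty. For every partition $\pi$ there is a unique sequence $\sigma_1,\dots,\sigma_m$ of nonempty connected partitions with $\pi=\sigma_1[\sigma_2]\cdots[\sigma_m]$; these are the components of $\pi$. Two non-crossing partitions $\sigma,\tau$ are cc-equivalent if there is a bijection from the set of all non-crossing partitions avoiding $\sigma$ to the set of all non-crossing partitions avoiding $\tau$ that preserves both the size and the number of components.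 Theorem. Let $\sigma_1,\dots,\sigma_k$ be (possibly empty) non-crossing partitions and let $p$ be a permutation of $\{1,\dots,k\}$. Then the partitions $$\sigma_1[\sigma_2]\cdots[\sigma_k]\quad\text{and}\quad \sigma_{p(1)}[\sigma_{p(2)}]\cdots[\sigma_{p(k)}]$$ are non-crossing and cc-equivalent. -/

import Mathlib

namespace NCPattern

/-- The largest symbol of a word (`0` for the empty word). -/
def maxSymbol (w : List ℕ) : ℕ := w.foldr max 0

/-- Restricted growth functions: all symbols are positive, and each symbol exceeds the maximum of
the preceding ones by at most one (so a nonempty word starts with `1`, and the set of symbols is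
`{1, …, k}`, see `IsRGF.toFinset_eq`). -/
def IsRGF (w : List ℕ) : Prop :=
  ∀ (i : ℕ) (h : i < w.length), 1 ≤ w[i] ∧ w[i] ≤ maxSymbol (w.take i) + 1

/-- A set partition of `{1, …, n}`, represented by its canonical sequential form
`π₁ π₂ ⋯ πₙ`: here `πⱼ = i` means that `j` lies in the `i`-th block, the blocks being
ordered by their minima. The empty word is the empty partition of `∅`. -/
@[ext]
structure SetPartition where
  word : List ℕ
  isRGF : IsRGF word

theorem isRGF_nil : IsRGF [] := fun i h => absurd h (by simp)

theorem isRGF_append_singleton (w : List ℕ) (a : ℕ) :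
    IsRGF (w ++ [a]) ↔ IsRGF w ∧ 1 ≤ a ∧ a ≤ maxSymbol w + 1 := by
  constructor
  · intro h
    refine ⟨fun i hi => ?_, ?_⟩
    · have := h i (by simp; omega)
      rw [List.getElem_append_left hi, List.take_append_of_le_length hi.le] at this
      exact this
    · have := h w.length (by simp)
      simpa using this
  · rintro ⟨h, ha⟩ i hi
    by_cases hiw : i < w.length
    · rw [List.getElem_append_left hiw, List.take_append_of_le_length hiw.le]
      exact h i hiw
    · have : i = w.length := by simp at hi; omega
      subst this
      simpa using ha

theorem maxSymbol_append (u v : List ℕ) :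
    maxSymbol (u ++ v) = max (maxSymbol u) (maxSymbol v) := by
  induction u with
  | nil => simp [maxSymbol]
  | cons a u ih =>
    simp only [maxSymbol, List.cons_append, List.foldr_cons] at ih ⊢
    rw [ih, max_assoc]

/-- The number of distinct symbols of a word; for a partition, the number of its blocks. -/
def numSymbols (w : List ℕ) : ℕ := w.toFinset.card

theorem IsRGF.toFinset_eq {w : List ℕ} (h : IsRGF w) :
    w.toFinset = Finset.Icc 1 (maxSymbol w) := by
  induction w using List.reverseRecOn with
  | nil => simp [maxSymbol]
  | append_singleton w a ih =>
    rw [isRGF_append_singleton] at h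
    have ih := ih h.1
    rw [List.toFinset_append, ih, maxSymbol_append]
    ext x
    simp [maxSymbol] at h ⊢
    omega

theorem IsRGF.numSymbols_eq {w : List ℕ} (h : IsRGF w) : numSymbols w = maxSymbol w := by
  simp [numSymbols, h.toFinset_eq]

theorem IsRGF.of_append {u v : List ℕ} (h : IsRGF (u ++ v)) : IsRGF u := by
  intro i hi
  have := h i (by simp; omega)
  rwa [List.getElem_append_left hi, List.take_append_of_le_length hi.le] at this

theorem maxSymbol_map_add (v : List ℕ) (m : ℕ) :
    max m (maxSymbol (v.map (· + m))) = maxSymbol v + m := by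
  induction v with
  | nil => simp [maxSymbol]
  | cons a v ih =>
    simp only [maxSymbol, List.map_cons, List.foldr_cons] at ih ⊢
    omega

theorem IsRGF.append {u v : List ℕ} (hu : IsRGF u) (hv : IsRGF v) :
    IsRGF (u ++ v.map (· + numSymbols u)) := by
  rw [hu.numSymbols_eq]
  induction v using List.reverseRecOn with
  | nil => simpa using hu
  | append_singleton v a ih =>
    rw [isRGF_append_singleton] at hv
    rw [List.map_append, ← List.append_assoc, List.map_singleton, isRGF_append_singleton,
      maxSymbol_append, maxSymbol_map_add]
    exact ⟨ih hv.1, by omega, by omega⟩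

theorem numSymbols_append {u v : List ℕ} (hu : IsRGF u) (hv : IsRGF v) :
    numSymbols (u ++ v.map (· + numSymbols u)) = numSymbols u + numSymbols v := by
  rw [(hu.append hv).numSymbols_eq, maxSymbol_append, hu.numSymbols_eq, hv.numSymbols_eq,
    maxSymbol_map_add, add_comm]

namespace SetPartition

/-- The size of a partition. -/
def size (π : SetPartition) : ℕ := π.word.length

/-- The empty partition. -/
def empty : SetPartition := ⟨[], isRGF_nil⟩

/-- The pattern `1212`. -/
def pattern1212 : SetPartition :=
  ⟨[1, 2, 1, 2], by
    intro i h
    have h' : i < 4 := h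
    interval_cases i <;> simp [maxSymbol]⟩

/-- The concatenation `σ[τ]`: the word `σ` followed by the word `τ + k`, where `k` is the number
of distinct symbols of `σ`. -/
def append (σ τ : SetPartition) : SetPartition :=
  ⟨σ.word ++ τ.word.map (· + numSymbols σ.word), σ.isRGF.append τ.isRGF⟩

/-- The concatenation `σ₁[σ₂]⋯[σₖ]` of a list of partitions. -/
def concat (l : List SetPartition) : SetPartition := l.foldl append empty

/-- `π` contains the pattern `τ`: it has a subsequence order-isomorphic to `τ`. -/
def Contains (π τ : SetPartition) : Prop :=
  ∃ f : Fin τ.word.length → Fin π.word.length, StrictMono f ∧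
    ∀ i j, (π.word.get (f i) < π.word.get (f j) ↔ τ.word.get i < τ.word.get j)

/-- `π` avoids the pattern `τ`. -/
def Avoids (π τ : SetPartition) : Prop := ¬ π.Contains τ

/-- Non-crossing partitions are the partitions that avoid `1212`. -/
def NonCrossing (π : SetPartition) : Prop := π.Avoids pattern1212

/-- `π` is connected if it is not of the form `σ[τ]` with `σ`, `τ` nonempty. -/
def Connected (π : SetPartition) : Prop :=
  ¬ ∃ σ τ : SetPartition, σ ≠ empty ∧ τ ≠ empty ∧ π = σ.append τ

/-- `l` is the sequence of components of `π`. -/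
def IsComponents (π : SetPartition) (l : List SetPartition) : Prop :=
  (∀ σ ∈ l, σ ≠ empty ∧ σ.Connected) ∧ concat l = π

theorem append_assoc (ρ σ τ : SetPartition) :
    (ρ.append σ).append τ = ρ.append (σ.append τ) := by
  ext1
  have h := numSymbols_append ρ.isRGF σ.isRGF
  simp only [append, List.map_append, List.append_assoc, List.map_map] at h ⊢
  rw [h]
  congr 3
  funext x
  simp only [Function.comp]
  omega

theorem empty_append (σ : SetPartition) : empty.append σ = σ := by
  ext1
  simp [append, empty, numSymbols]

theorem append_empty (σ : SetPartition) : σ.append empty = σ := by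
  ext1
  simp [append, empty]

theorem foldl_append (l : List SetPartition) (σ : SetPartition) :
    l.foldl append σ = σ.append (concat l) := by
  induction l generalizing σ with
  | nil => simp [concat, append_empty]
  | cons a l ih =>
    simp only [concat, List.foldl_cons]
    rw [ih, ih (empty.append a), empty_append, append_assoc]

theorem concat_cons (σ : SetPartition) (l : List SetPartition) :
    concat (σ :: l) = σ.append (concat l) := by
  rw [concat, List.foldl_cons, empty_append, foldl_append]

theorem concat_append (l₁ l₂ : List SetPartition) :
    concat (l₁ ++ l₂) = (concat l₁).append (concat l₂) := by
  rw [concat, List.foldl_append, foldl_append]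
  rfl

theorem size_append (σ τ : SetPartition) : (σ.append τ).size = σ.size + τ.size := by
  simp [size, append]

theorem size_eq_zero {σ : SetPartition} : σ.size = 0 ↔ σ = empty := by
  rw [size, List.length_eq_zero_iff, SetPartition.ext_iff]
  rfl

theorem size_pos {σ : SetPartition} (h : σ ≠ empty) : 0 < σ.size :=
  Nat.pos_of_ne_zero fun h0 => h (size_eq_zero.1 h0)

theorem exists_isComponents (π : SetPartition) : ∃ l, IsComponents π l := by
  induction hn : π.size using Nat.strong_induction_on generalizing π with
  | _ n ih =>
    by_cases h0 : π = empty
    · exact ⟨[], by simp, by rw [h0]; rfl⟩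
    by_cases hc : π.Connected
    · exact ⟨[π], by simp [h0, hc], by rw [concat_cons]; exact append_empty π⟩
    · obtain ⟨σ, τ, hσ, hτ, rfl⟩ := not_not.1 hc
      have h1 := size_pos hσ
      have h2 := size_pos hτ
      rw [size_append] at hn
      obtain ⟨l₁, h₁, e₁⟩ := ih σ.size (by omega) σ rfl
      obtain ⟨l₂, h₂, e₂⟩ := ih τ.size (by omega) τ rfl
      refine ⟨l₁ ++ l₂, fun x hx => ?_, by rw [concat_append, e₁, e₂]⟩
      rcases List.mem_append.1 hx with hx | hx
      · exact h₁ x hx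
      · exact h₂ x hx

theorem append_eq_append_aux {a b c d : SetPartition} (ha : a ≠ empty) (hc : c.Connected)
    (h : a.append b = c.append d) (hle : a.size ≤ c.size) : a = c := by
  have hw : a.word ++ b.word.map (· + numSymbols a.word) =
      c.word ++ d.word.map (· + numSymbols c.word) := congrArg word h
  obtain ⟨t, ht, ht'⟩ : ∃ t, c.word = a.word ++ t ∧
      b.word.map (· + numSymbols a.word) = t ++ d.word.map (· + numSymbols c.word) := by
    rcases List.append_eq_append_iff.1 hw with ⟨t, h1, h2⟩ | ⟨t, h1, h2⟩
    · exact ⟨t, h1, h2⟩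
    · have : t = [] := by
        have := congrArg List.length h1
        simp only [List.length_append, size] at this hle
        exact List.length_eq_zero_iff.1 (by omega)
      subst this
      exact ⟨[], by simpa using h1.symm, by simpa using h2.symm⟩
  obtain ⟨e, g, hb, he, -⟩ := List.map_eq_append_iff.1 ht'
  have hE : IsRGF e := IsRGF.of_append (v := g) (hb ▸ b.isRGF)
  have hce : c = a.append ⟨e, hE⟩ := by
    ext1
    rw [ht, ← he]
    rfl
  by_cases h0 : (⟨e, hE⟩ : SetPartition) = empty
  · rw [hce, h0, append_empty]
  · exact absurd ⟨a, _, ha, h0, hce⟩ hc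

theorem append_left_cancel {a b d : SetPartition} (h : a.append b = a.append d) : b = d := by
  have hw : a.word ++ b.word.map (· + numSymbols a.word) =
      a.word ++ d.word.map (· + numSymbols a.word) := congrArg word h
  ext1
  exact (List.map_injective_iff.2 (add_left_injective _)) (List.append_cancel_left hw)

theorem isComponents_unique {π : SetPartition} {l₁ l₂ : List SetPartition}
    (h₁ : IsComponents π l₁) (h₂ : IsComponents π l₂) : l₁ = l₂ := by
  have key : ∀ (a : SetPartition) (l : List SetPartition), a ≠ empty →
      concat (a :: l) ≠ empty := by
    intro a l ha h
    have h1 := size_pos ha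
    rw [concat_cons, ← size_eq_zero, size_append] at h
    omega
  induction l₁ generalizing π l₂ with
  | nil =>
    cases l₂ with
    | nil => rfl
    | cons c l₂ => exact absurd (h₂.2.trans h₁.2.symm) (key c l₂ (h₂.1 c (by simp)).1)
  | cons a l₁ ih =>
    cases l₂ with
    | nil => exact absurd (h₁.2.trans h₂.2.symm) (key a l₁ (h₁.1 a (by simp)).1)
    | cons c l₂ =>
      have ha := h₁.1 a (by simp)
      have hc := h₂.1 c (by simp)
      have h := h₁.2.trans h₂.2.symm
      rw [concat_cons, concat_cons] at h
      have hac : a = c := by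
        rcases le_total a.size c.size with hle | hle
        · exact append_eq_append_aux ha.1 hc.2 h hle
        · exact (append_eq_append_aux hc.1 ha.2 h.symm hle).symm
      subst hac
      have := append_left_cancel h
      rw [ih ⟨fun σ hσ => h₁.1 σ (by simp [hσ]), this⟩
        ⟨fun σ hσ => h₂.1 σ (by simp [hσ]), rfl⟩]

theorem existsUnique_isComponents (π : SetPartition) : ∃! l, IsComponents π l :=
  let ⟨l, hl⟩ := exists_isComponents π
  ⟨l, hl, fun _ h => isComponents_unique h hl⟩

/-- The sequence of components of `π`: the unique sequence `σ₁, …, σₘ` of nonempty connected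
partitions with `π = σ₁[σ₂]⋯[σₘ]`. -/
noncomputable def components (π : SetPartition) : List SetPartition :=
  (existsUnique_isComponents π).choose

theorem components_spec (π : SetPartition) : IsComponents π π.components :=
  (existsUnique_isComponents π).choose_spec.1

/-- The number of components of `π`. -/
noncomputable def numComponents (π : SetPartition) : ℕ := π.components.length

/-- The set of non-crossing partitions (of all sizes) that avoid `σ`. -/
def ncAvoiders (σ : SetPartition) : Set SetPartition := {π | π.NonCrossing ∧ π.Avoids σ}

/-- The non-crossing partitions `σ` and `τ` are cc-equivalent: there is a bijection from the
non-crossing `σ`-avoiders to the non-crossing `τ`-avoiders that preserves the size and the number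
of components. -/
def CCEquiv (σ τ : SetPartition) : Prop :=
  σ.NonCrossing ∧ τ.NonCrossing ∧
    ∃ f : ncAvoiders σ → ncAvoiders τ, Function.Bijective f ∧
      ∀ π : ncAvoiders σ, (f π : SetPartition).size = (π : SetPartition).size ∧
        (f π : SetPartition).numComponents = (π : SetPartition).numComponents

end SetPartition

end NCPattern

/-!
It is enough to permute connected nonempty patterns, as every `σᵢ` is the concatenation of its
components, and it is enough to count the non-crossing partitions that *contain* the pattern, by
size and number of components.

A non-crossing partition is built symbol by symbol: either a new block is opened, or one of the
components is continued by its first symbol, which merges all later components into it (`IsNC`,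
`stack`, `SetPartition.numComponents_eq`).

Let `α` be connected and nonempty, so that its word ends with its smallest symbol `1`. If `π`
contains `α`, let `κ` be the shortest prefix of `π` that contains `α`, and let `ρ` be the partition
formed by the symbols of `π` that do not occur in `κ`. Then `π` contains `α[τ]` if and only if `ρ`
contains `τ` (`MinOccurs.occurs_append_iff`). Given `κ` with `C` components and `ρ` with `c`
components, `π` is recovered from the places of the old symbols between the components of `ρ`.
These places form a chain in `{0, …, C - 1} × {0, …, c}`, whose last element determines the number
of components of `π` (`card_extensions`).

In terms of generating functions, with `x` marking size and `y` marking components, the passage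
from `τ` to `α[τ]` is the operator `∑ x ^ |κ| P_C`, where `P_C` is the linear operator (`stepOp`)
that sends `y ^ c` to the generating function of such chains. From the recurrences of the latter,
`P_{C+2} = P_{C+1} + (1 - x) P_1 P_{C+1} - P_1 P_C` with `P_0 = 1` (`stepOp_add_two`). Hence all
`P_C` are polynomials in `P_1`, the operators belonging to two connected patterns `α` and `β`
commute, and the order of the parts is irrelevant (`SetPartition.truncEq_of_perm`). As the
generating functions are infinite sums of polynomials in `y`, they are truncated at a size `N`, and
the identities hold modulo `x ^ (N + 1)`.
-/

namespace NCPattern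

/-! ### Commuting operators from chains in the plane -/

/-- A geometric convolution commutes with partial summation. -/
theorem sum_range_geom_comm {A : Type*} [CommRing A] (y : A) (f : ℕ → A) (p : ℕ) :
    ∑ i ∈ Finset.range (p + 1), (∑ j ∈ Finset.range (i + 1), f j) * y ^ (p - i) =
      ∑ i ∈ Finset.range (p + 1), ∑ j ∈ Finset.range (i + 1), f j * y ^ (i - j) := by
  have hB : ∀ (h : ℕ → A) p, ∑ j ∈ Finset.range (p + 1 + 1), h j * y ^ (p + 1 - j) =
      y * ∑ j ∈ Finset.range (p + 1), h j * y ^ (p - j) + h (p + 1) := by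
    intro h p
    rw [Finset.sum_range_succ, Finset.mul_sum]
    congr 1
    · refine Finset.sum_congr rfl fun j hj => ?_
      rw [Nat.succ_sub (Finset.mem_range_succ_iff.1 hj), pow_succ]
      ring
    · simp
  have hV : ∀ p, (y - 1) * ∑ i ∈ Finset.range (p + 1), ∑ j ∈ Finset.range (i + 1), f j * y ^ (i - j)
      = y * ∑ j ∈ Finset.range (p + 1), f j * y ^ (p - j) - ∑ j ∈ Finset.range (p + 1), f j := by
    intro p
    induction p with
    | zero => simp; ring
    | succ p ih =>
      rw [Finset.sum_range_succ, mul_add, ih, hB, Finset.sum_range_succ f (p + 1)]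
      ring
  induction p with
  | zero => simp
  | succ p ih =>
    rw [hB (fun i => ∑ j ∈ Finset.range (i + 1), f j), ih, Finset.sum_range_succ f (p + 1),
      Finset.sum_range_succ (fun i => ∑ j ∈ Finset.range (i + 1), f j * y ^ (i - j)) (p + 1), hB]
    linear_combination hV p

/-- The number of weakly increasing sequences of length `k` in `ℕ × ℕ`, with the product order,
that end in `(i, g)`; the empty sequence counts as ending in `(0, 0)`. -/
def chainCount : ℕ → ℕ → ℕ → ℕ
  | 0, i, g => if i = 0 ∧ g = 0 then 1 else 0
  | k + 1, i, g => ∑ i' ∈ Finset.range (i + 1), ∑ g' ∈ Finset.range (g + 1), chainCount k i' g'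

/-- The generating function, by length, of the weakly increasing sequences in `ℕ × ℕ` that end
in `(i, g)`. -/
noncomputable def chainSeries (i g : ℕ) : PowerSeries ℤ :=
  PowerSeries.mk fun k => (chainCount k i g : ℤ)

theorem chainSeries_eq (i g : ℕ) :
    chainSeries i g = (if i = 0 ∧ g = 0 then 1 else 0) + PowerSeries.X *
      ∑ i' ∈ Finset.range (i + 1), ∑ g' ∈ Finset.range (g + 1), chainSeries i' g' := by
  ext k
  cases k with
  | zero => simp [chainSeries, chainCount, apply_ite]
  | succ k =>
    rw [map_add, PowerSeries.coeff_succ_X_mul, map_sum]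
    simp only [map_sum, chainSeries, PowerSeries.coeff_mk, chainCount]
    push_cast
    rw [right_eq_add]
    split_ifs <;> simp [PowerSeries.coeff_one]

open Polynomial in
/-- The sum of `chainSeries i g * y ^ (p - i + (c - g))` over `i ≤ p` and `g ≤ c`. -/
noncomputable def chainPoly (p c : ℕ) : (PowerSeries ℤ)[X] :=
  ∑ i ∈ Finset.range (p + 1), (∑ g ∈ Finset.range (c + 1),
    Polynomial.C (chainSeries i g) * X ^ (c - g)) * X ^ (p - i)

open Polynomial in
/-- Splitting off the first term of a chain. -/
theorem chainPoly_eq (p c : ℕ) :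
    chainPoly p c = X ^ (p + c) + C (PowerSeries.X) *
      ∑ i ∈ Finset.range (p + 1), ∑ g ∈ Finset.range (c + 1), chainPoly i g := by
  have h1 : chainPoly p c = X ^ (p + c) + C (PowerSeries.X) *
      ∑ i ∈ Finset.range (p + 1), (∑ g ∈ Finset.range (c + 1),
        (∑ g' ∈ Finset.range (g + 1), ∑ i' ∈ Finset.range (i + 1), C (chainSeries i' g')) *
          X ^ (c - g)) * X ^ (p - i) := by
    have h2 : (X : (PowerSeries ℤ)[X]) ^ (p + c) = ∑ i ∈ Finset.range (p + 1),
        (∑ g ∈ Finset.range (c + 1), (if i = 0 ∧ g = 0 then 1 else 0) * X ^ (c - g)) *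
          X ^ (p - i) := by
      rw [Finset.sum_eq_single 0, Finset.sum_eq_single 0]
      · simp [← pow_add, add_comm]
      · intro b _ hb; simp [hb]
      · simp
      · intro b _ hb; simp [hb]
      · simp
    rw [h2, Finset.mul_sum, ← Finset.sum_add_distrib, chainPoly]
    refine Finset.sum_congr rfl fun i _ => ?_
    rw [← mul_assoc, ← add_mul, Finset.mul_sum, ← Finset.sum_add_distrib]
    congr 1
    refine Finset.sum_congr rfl fun g _ => ?_
    rw [← mul_assoc, ← add_mul, chainSeries_eq, Finset.sum_comm]
    simp only [map_add, map_mul, map_sum]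
    split_ifs <;> simp
  rw [h1]
  congr 2
  have h3 : ∀ i, (∑ g ∈ Finset.range (c + 1),
        (∑ g' ∈ Finset.range (g + 1), ∑ i' ∈ Finset.range (i + 1), C (chainSeries i' g')) *
          (X : (PowerSeries ℤ)[X]) ^ (c - g)) = ∑ i' ∈ Finset.range (i + 1),
          ∑ g ∈ Finset.range (c + 1), ∑ g' ∈ Finset.range (g + 1),
            C (chainSeries i' g') * X ^ (g - g') := by
    intro i
    rw [sum_range_geom_comm, Finset.sum_comm (s := Finset.range (i + 1))]
    refine Finset.sum_congr rfl fun g _ => ?_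
    rw [Finset.sum_comm]
    refine Finset.sum_congr rfl fun g _ => ?_
    rw [Finset.sum_mul]
  simp only [h3]
  rw [sum_range_geom_comm]
  refine Finset.sum_congr rfl fun i _ => ?_
  simp only [chainPoly]
  rw [Finset.sum_comm]
  refine Finset.sum_congr rfl fun j _ => ?_
  rw [Finset.sum_mul]

open Polynomial in
/-- `stepPoly C c` enumerates the ways of continuing a non-crossing word with `C` components,
interleaving a fixed partition with `c` components on new symbols with old symbols:
the power series variable marks the old symbols, the polynomial variable the resulting number
of components. For `C = 0` there are no old symbols. -/
noncomputable def stepPoly : ℕ → ℕ → (PowerSeries ℤ)[X]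
  | 0, c => X ^ c
  | p + 1, c => X * chainPoly p c

open Polynomial in
theorem stepPoly_succ_zero (n : ℕ) :
    C (1 - PowerSeries.X) * stepPoly (n + 1) 0 = stepPoly n 0 + X ^ (n + 1) - X ^ n := by
  cases n with
  | zero =>
    have := chainPoly_eq 0 0
    simp [stepPoly] at this ⊢
    linear_combination X * this
  | succ n =>
    have h1 := chainPoly_eq n 0
    have h2 := chainPoly_eq (n + 1) 0
    rw [Finset.sum_range_succ _ (n + 1)] at h2
    simp [stepPoly] at h1 h2 ⊢
    linear_combination X * h2 - X * h1

open Polynomial in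
theorem stepPoly_succ_succ (n c : ℕ) :
    C (1 - PowerSeries.X) * stepPoly (n + 1) (c + 1) = stepPoly n (c + 1) + stepPoly (n + 1) c -
      stepPoly n c + X ^ (n + c) * (X - 1) ^ 2 := by
  cases n with
  | zero =>
    have h1 := chainPoly_eq 0 c
    have h2 := chainPoly_eq 0 (c + 1)
    simp [stepPoly, Finset.sum_range_succ _ (c + 1)] at h1 h2 ⊢
    linear_combination X * h2 - X * h1
  | succ n =>
    have h1 := chainPoly_eq n c
    have h2 := chainPoly_eq n (c + 1)
    have h3 := chainPoly_eq (n + 1) c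
    have h4 := chainPoly_eq (n + 1) (c + 1)
    simp only [Finset.sum_range_succ _ (n + 1), Finset.sum_range_succ _ (c + 1),
      Finset.sum_add_distrib] at h1 h2 h3 h4
    simp only [stepPoly, map_sub, map_one]
    linear_combination X * (h4 - h3 - h2 + h1)

open Polynomial in
/-- The linear operator that sends `y ^ c` to `stepPoly n c`. -/
noncomputable def stepOp (n : ℕ) : Module.End (PowerSeries ℤ) (PowerSeries ℤ)[X] :=
  Polynomial.lsum fun c => LinearMap.toSpanSingleton (PowerSeries ℤ) _ (stepPoly n c)

open Polynomial in
theorem stepOp_monomial (n c : ℕ) (r : PowerSeries ℤ) :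
    stepOp n (monomial c r) = r • stepPoly n c := by
  simp [stepOp, Polynomial.lsum_apply]

open Polynomial in
theorem stepOp_X_pow (n c : ℕ) : stepOp n (X ^ c) = stepPoly n c := by
  rw [X_pow_eq_monomial, stepOp_monomial, one_smul]

theorem stepOp_zero : stepOp 0 = 1 := by
  refine Polynomial.lhom_ext' fun c => LinearMap.ext_ring ?_
  simp [stepOp_monomial, stepPoly, Polynomial.X_pow_eq_monomial]

open Polynomial in
/-- The recurrence `stepPoly_succ_succ`, extended by linearity. -/
theorem stepOp_succ_X_mul (n : ℕ) (f : (PowerSeries ℤ)[X]) :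
    C (1 - PowerSeries.X) * stepOp (n + 1) (X * f) =
      stepOp n (X * f) + stepOp (n + 1) f - stepOp n f + X ^ n * (X - 1) ^ 2 * f := by
  induction f using Polynomial.induction_on' with
  | add f g hf hg =>
    simp only [mul_add, map_add] at hf hg ⊢
    linear_combination hf + hg
  | monomial c r =>
    rw [X_mul_monomial]
    simp only [stepOp_monomial, smul_eq_C_mul]
    rw [← C_mul_X_pow_eq_monomial]
    linear_combination C r * stepPoly_succ_succ n c

open Polynomial in
/-- A three-term recurrence, which expresses every `stepOp n` through `stepOp 1`. -/
theorem stepOp_add_two (n : ℕ) :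
    stepOp (n + 2) = stepOp (n + 1) + (1 - PowerSeries.X : PowerSeries ℤ) •
      (stepOp 1 * stepOp (n + 1)) - stepOp 1 * stepOp n := by
  have ha : C (1 - PowerSeries.X : PowerSeries ℤ) ≠ 0 := by
    rw [Ne, C_eq_zero]
    intro h
    simpa using congrArg (PowerSeries.coeff 0) h
  have hsmul : ∀ n (r : PowerSeries ℤ) f, stepOp n (C r * f) = C r * stepOp n f := by
    intro n r f
    rw [← smul_eq_C_mul, map_smul, smul_eq_C_mul]
  replace hsmul := fun n => hsmul n (1 - PowerSeries.X)
  have hzero := stepPoly_succ_zero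
  have hX := stepOp_succ_X_mul
  obtain ⟨a, hadef⟩ : ∃ a, a = C (1 - PowerSeries.X : PowerSeries ℤ) := ⟨_, rfl⟩
  rw [← hadef] at ha
  simp only [← hadef] at hsmul hzero hX
  have key1 : ∀ f, a * stepOp 1 (X * f) =
      stepOp 1 f + X ^ 2 * f - X * f := by
    intro f
    have := hX 0 f
    simp only [stepOp_zero, Module.End.one_apply, zero_add] at this
    rw [this]; ring
  -- The values of both sides at `1`; then multiplication by the polynomial variable is pushed
  -- through all operators by `stepOp_succ_X_mul`.
  have key2 : ∀ n, stepPoly (n + 2) 0 = stepPoly (n + 1) 0 + a *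
      stepOp 1 (stepPoly (n + 1) 0) - stepOp 1 (stepPoly n 0) := by
    intro n
    induction n with
    | zero =>
      apply mul_left_cancel₀ ha
      have h2 := hzero 1
      have h1 := hzero 0
      have h3 := congrArg (stepOp 1) h1
      have h4 := key1 1
      rw [hsmul] at h3
      have h5 : stepOp 1 1 = X * chainPoly 0 0 := stepOp_X_pow 1 0
      simp only [stepPoly, pow_zero, zero_add, pow_one, add_sub_cancel_left, mul_one] at h1 h2 h3 h4 ⊢
      linear_combination h2 - a * h3 - h4 + (a - 1) * h5
    | succ n ih =>
      apply mul_left_cancel₀ ha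
      have h3 := hzero (n + 2)
      have h2 := hzero (n + 1)
      have h1 := hzero n
      have h2' := congrArg (stepOp 1) h2
      have h1' := congrArg (stepOp 1) h1
      rw [hsmul] at h1' h2'
      have h4 := key1 (X ^ (n + 1))
      have h5 := key1 (X ^ n)
      rw [← pow_succ'] at h4 h5
      simp only [map_add, map_sub] at h1' h2' 
      linear_combination h3 - h2 + ih - a * h2' + h1' - h4 + h5
  suffices h : ∀ n c, stepOp (n + 2) (X ^ c) = stepOp (n + 1) (X ^ c) + a *
      stepOp 1 (stepOp (n + 1) (X ^ c)) - stepOp 1 (stepOp n (X ^ c)) by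
    refine Polynomial.lhom_ext' fun c => LinearMap.ext_ring ?_
    have := h n c
    rw [X_pow_eq_monomial, hadef, ← smul_eq_C_mul] at this
    exact this
  intro n
  induction n with
  | zero =>
    intro c
    induction c with
    | zero => simpa only [stepOp_X_pow] using key2 0
    | succ c ihc =>
      apply mul_left_cancel₀ ha
      rw [pow_succ']
      generalize (X : (PowerSeries ℤ)[X]) ^ c = f at *
      have h2 := hX 1 f
      have h1 := congrArg (stepOp 1) (key1 f)
      have h3 := key1 (X * f)
      have h4 := key1 f
      have h5 : stepOp 1 (X ^ 2 * f) = stepOp 1 (X * (X * f)) := by congr 1; ring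
      rw [hsmul] at h1
      simp only [map_add, map_sub, stepOp_zero, Module.End.one_apply, zero_add] at *
      linear_combination h2 + ihc - a * h1 - a * h5 - h3 + h4
  | succ n ihn =>
    intro c
    induction c with
    | zero => simpa only [stepOp_X_pow] using key2 (n + 1)
    | succ c ihc =>
      apply mul_left_cancel₀ ha
      have i1 := ihn c
      have i2 := ihn (c + 1)
      rw [pow_succ'] at i2 ⊢
      generalize (X : (PowerSeries ℤ)[X]) ^ c = f at *
      have h3 := hX (n + 2) f
      have h2 := hX (n + 1) f
      have h1 := hX n f
      have h2' := congrArg (stepOp 1) h2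
      have h1' := congrArg (stepOp 1) h1
      have h4 := key1 (X ^ n * (X - 1) ^ 2 * f)
      have h5 : stepOp 1 (X ^ (n + 1) * (X - 1) ^ 2 * f) =
        stepOp 1 (X * (X ^ n * (X - 1) ^ 2 * f)) := by congr 1; ring
      rw [hsmul] at h1' h2'
      simp only [map_add, map_sub] at h1' h2'
      linear_combination h3 - h2 + ihc + i2 - i1 - a * h2' + h1' - h4 -
        a * h5

/-- All operators `stepOp n` are polynomials in `stepOp 1`, so they commute. -/
theorem stepOp_commute (m n : ℕ) : Commute (stepOp m) (stepOp n) := by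
  have key : ∀ Q : Module.End (PowerSeries ℤ) (Polynomial (PowerSeries ℤ)),
      Commute Q (stepOp 1) → ∀ n, Commute Q (stepOp n) := by
    intro Q h1 n
    induction n using Nat.twoStepInduction with
    | zero => rw [stepOp_zero]; exact Commute.one_right _
    | one => exact h1
    | more n ih0 ih1 =>
      rw [stepOp_add_two]
      exact Commute.sub_right (R := Module.End (PowerSeries ℤ) (Polynomial (PowerSeries ℤ)))
        (ih1.add_right ((h1.mul_right ih1).smul_right _)) (h1.mul_right ih0)
  exact key _ ((key _ (Commute.refl _) m).symm) n

/-! ### Words of non-crossing partitions -/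

theorem le_maxSymbol {w : List ℕ} {x : ℕ} (h : x ∈ w) : x ≤ maxSymbol w := by
  induction w with
  | nil => simp at h
  | cons a w ih =>
    simp only [maxSymbol, List.foldr_cons] at ih ⊢
    rcases List.mem_cons.1 h with rfl | h
    · exact le_max_left _ _
    · exact le_max_of_le_right (ih h)

theorem maxSymbol_concat (w : List ℕ) (z : ℕ) : maxSymbol (w ++ [z]) = max (maxSymbol w) z := by
  rw [maxSymbol_append]
  simp [maxSymbol]

theorem IsRGF.mem_iff {w : List ℕ} (h : IsRGF w) {x : ℕ} : x ∈ w ↔ 1 ≤ x ∧ x ≤ maxSymbol w := by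
  rw [← List.mem_toFinset, h.toFinset_eq, Finset.mem_Icc]

/-- The symbols of the word `w` that have no smaller symbol after their last occurrence. For a
non-crossing partition, these are the old symbols by which the word may be continued. -/
def stack (w : List ℕ) : Finset ℕ := w.foldl (fun s z => insert z (s.filter (· < z))) ∅

@[simp] theorem stack_nil : stack [] = ∅ := rfl

@[simp] theorem stack_concat (w : List ℕ) (z : ℕ) :
    stack (w ++ [z]) = insert z ((stack w).filter (· < z)) := by
  simp [stack]

theorem mem_of_mem_stack {w : List ℕ} {x : ℕ} (h : x ∈ stack w) : x ∈ w := by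
  induction w using List.reverseRecOn with
  | nil => simp at h
  | append_singleton w z ih =>
    simp only [stack_concat, Finset.mem_insert, Finset.mem_filter] at h
    rcases h with rfl | h
    · simp
    · simp [ih h.1]

theorem mem_right_of_mem_stack {p q : List ℕ} {b x : ℕ} (h : x ∈ stack (p ++ b :: q))
    (hb : b < x) : x ∈ q := by
  induction q using List.reverseRecOn with
  | nil =>
    simp only [stack_concat, Finset.mem_insert, Finset.mem_filter] at h
    omega
  | append_singleton q z ih =>
    rw [← List.cons_append, ← List.append_assoc] at h
    simp only [stack_concat, Finset.mem_insert, Finset.mem_filter] at h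
    rcases h with rfl | h
    · simp
    · simp [ih h.1]

theorem mem_stack {w : List ℕ} {x : ℕ} (h : x ∈ w)
    (hx : ∀ p b q, w = p ++ b :: q → x ∈ p → x ≤ b) : x ∈ stack w := by
  induction w using List.reverseRecOn with
  | nil => simp at h
  | append_singleton w z ih =>
    simp only [stack_concat, Finset.mem_insert, Finset.mem_filter]
    rw [or_iff_not_imp_left]
    intro hxz
    have hw : x ∈ w := by simpa [hxz] using h
    refine ⟨ih hw fun p b q hpq hp => hx p b (q ++ [z]) (by simp [hpq]) hp, ?_⟩
    have := hx w z [] rfl hw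
    omega

/-- The symbols that can be appended to a non-crossing word. -/
def nextSymbols (w : List ℕ) : Finset ℕ := insert (maxSymbol w + 1) (stack w)

/-- The words that represent non-crossing partitions, built symbol by symbol; see
`SetPartition.nonCrossing_iff`. -/
inductive IsNC : List ℕ → Prop
  | nil : IsNC []
  | concat {w : List ℕ} {z : ℕ} : IsNC w → z ∈ nextSymbols w → IsNC (w ++ [z])

theorem isNC_concat_iff {w : List ℕ} {z : ℕ} :
    IsNC (w ++ [z]) ↔ IsNC w ∧ z ∈ nextSymbols w := by
  refine ⟨fun h => ?_, fun h => h.1.concat h.2⟩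
  generalize hu : w ++ [z] = u at h
  cases h with
  | nil => simp at hu
  | concat h hz =>
    obtain ⟨rfl, h2⟩ := List.append_inj' hu rfl
    obtain rfl : z = _ := by simpa using h2
    exact ⟨h, hz⟩

theorem IsNC.isRGF {w : List ℕ} (h : IsNC w) : IsRGF w := by
  induction h with
  | nil => exact isRGF_nil
  | @concat w z _ hz ih =>
    rw [isRGF_append_singleton]
    refine ⟨ih, ?_⟩
    rcases Finset.mem_insert.1 hz with rfl | hz
    · omega
    · have := ih.mem_iff.1 (mem_of_mem_stack hz)
      omega

theorem IsNC.of_append {u v : List ℕ} (h : IsNC (u ++ v)) : IsNC u := by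
  induction v using List.reverseRecOn with
  | nil => simpa using h
  | append_singleton v z ih =>
    rw [← List.append_assoc] at h
    exact ih (isNC_concat_iff.1 h).1

/-- In a non-crossing word, a symbol `b` closes all the blocks whose symbol is larger. -/
theorem IsNC.not_mem_of_lt {p q : List ℕ} {b x : ℕ} (h : IsNC (p ++ b :: q)) (hx : x ∈ q)
    (hb : b < x) : x ∉ p := by
  induction q using List.reverseRecOn with
  | nil => simp at hx
  | append_singleton q z ih =>
    rw [← List.cons_append, ← List.append_assoc, isNC_concat_iff] at h
    by_cases hq : x ∈ q
    · exact ih h.1 hq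
    · obtain rfl : x = z := by simpa [hq] using hx
      rcases Finset.mem_insert.1 h.2 with hz | hz
      · intro hp
        have := le_maxSymbol (w := p ++ b :: q) (x := x) (by simp [hp])
        omega
      · exact absurd (mem_right_of_mem_stack hz hb) hq

theorem IsNC.maxSymbol_lt {p q : List ℕ} {b x : ℕ} (h : IsNC (p ++ b :: q)) (hx : x ∈ q)
    (hb : b < x) : maxSymbol (p ++ [b]) < x := by
  have h1 := h.not_mem_of_lt hx hb
  have h2 : IsRGF (p ++ [b]) := (IsNC.of_append (v := q) (by simpa using h)).isRGF
  by_contra h3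
  have := h2.mem_iff (x := x)
  simp [h1] at this
  omega

/-- The converse of `IsNC.not_mem_of_lt`. -/
theorem isNC_of_not_mem {w : List ℕ} (h : IsRGF w)
    (hw : ∀ p b q x, w = p ++ b :: q → x ∈ q → b < x → x ∉ p) : IsNC w := by
  induction w using List.reverseRecOn with
  | nil => exact .nil
  | append_singleton w z ih =>
    rw [isRGF_append_singleton] at h
    refine (ih h.1 fun p b q x hpq hx => hw p b (q ++ [z]) x (by simp [hpq]) (by simp [hx])).concat ?_
    rw [nextSymbols, Finset.mem_insert, or_iff_not_imp_left]
    intro hz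
    refine mem_stack (h.1.mem_iff.2 (by omega)) fun p b q hpq hp => ?_
    by_contra hb
    exact hw p b (q ++ [z]) z (by simp [hpq]) (by simp) (by omega) hp

/-! ### Containment of words and of partitions -/

/-- The word `w` has a subsequence that is order-isomorphic to the word `u`. -/
def Occurs (u w : List ℕ) : Prop := ∃ f : ℕ → ℕ, StrictMonoOn f {x | x ∈ u} ∧ (u.map f).Sublist w

theorem Occurs.mono {u w w' : List ℕ} (h : Occurs u w) (hw : w.Sublist w') : Occurs u w' :=
  let ⟨f, hf, h⟩ := h
  ⟨f, hf, h.trans hw⟩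

theorem SetPartition.contains_iff (π τ : SetPartition) :
    π.Contains τ ↔ Occurs τ.word π.word := by
  constructor
  · rintro ⟨F, hF, h⟩
    classical
    have heq : ∀ i j, τ.word.get i = τ.word.get j → π.word.get (F i) = π.word.get (F j) := by
      intro i j hij
      have h1 := h i j
      have h2 := h j i
      omega
    let f : ℕ → ℕ := fun x => if hx : ∃ i, τ.word.get i = x then π.word.get (F hx.choose) else 0
    have hf : ∀ i, f (τ.word.get i) = π.word.get (F i) := by
      intro i
      have hx : ∃ j, τ.word.get j = τ.word.get i := ⟨i, rfl⟩
      simp only [f, dif_pos hx]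
      exact heq _ _ hx.choose_spec
    refine ⟨f, ?_, ?_⟩
    · intro x hx y hy hxy
      obtain ⟨i, rfl⟩ := List.get_of_mem hx
      obtain ⟨j, rfl⟩ := List.get_of_mem hy
      rw [hf, hf]
      exact (h i j).2 hxy
    · rw [List.sublist_iff_exists_fin_orderEmbedding_get_eq]
      refine ⟨(Fin.castOrderIso (by simp)).toOrderEmbedding.trans
        (OrderEmbedding.ofStrictMono F hF), fun i => ?_⟩
      have := hf (Fin.cast (by simp) i)
      simpa using this
  · rintro ⟨f, hf, h⟩
    rw [List.sublist_iff_exists_fin_orderEmbedding_get_eq] at h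
    obtain ⟨F, hF⟩ := h
    refine ⟨fun i => F (Fin.cast (by simp) i), fun i j hij => F.strictMono (by simpa using hij),
      fun i j => ?_⟩
    have h1 := hF (Fin.cast (by simp) i)
    have h2 := hF (Fin.cast (by simp) j)
    rw [← h1, ← h2]
    simpa using hf.lt_iff_lt (a := τ.word.get i) (b := τ.word.get j) (by simp) (by simp)

theorem SetPartition.nonCrossing_iff (π : SetPartition) : π.NonCrossing ↔ IsNC π.word := by
  rw [NonCrossing, Avoids, contains_iff]
  constructor
  · intro h
    refine isNC_of_not_mem π.isRGF fun p b q x hw hx hb hp => h ?_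
    obtain ⟨p₁, p₂, rfl⟩ := List.append_of_mem hp
    have hr := π.isRGF
    rw [hw] at hr
    have hr1 : IsRGF (p₁ ++ [x]) := IsRGF.of_append (v := p₂ ++ b :: q) (by simpa using hr)
    have hb1 : 1 ≤ b := (hr.mem_iff.1 (by simp)).1
    rw [isRGF_append_singleton] at hr1
    have hbp : b ∈ p₁ := hr1.1.mem_iff.2 (by omega)
    refine ⟨fun i => if i = 1 then b else x, ?_, ?_⟩
    · intro i hi j hj hij
      have hi' : i = 1 ∨ i = 2 := by simp [pattern1212] at hi; omega
      have hj' : j = 1 ∨ j = 2 := by simp [pattern1212] at hj; omega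
      obtain ⟨rfl, rfl⟩ : i = 1 ∧ j = 2 := by omega
      simpa using hb
    · have h1 : [b, x].Sublist (p₁ ++ x :: p₂) := by
        have : [b].Sublist p₁ := List.singleton_sublist.2 hbp
        exact this.append (List.singleton_sublist.2 (by simp))
      have h2 : [b, x].Sublist (b :: q) := by simpa using hx
      rw [hw]
      exact h1.append h2
  · rintro h ⟨f, hf, hs⟩
    have hlt : f 1 < f 2 := hf (by simp [pattern1212]) (by simp [pattern1212]) (by norm_num)
    have hs : ([f 1, f 2] ++ [f 1, f 2]).Sublist π.word := hs
    obtain ⟨r₁, r₂, hr, h1, h2⟩ := List.append_sublist_iff.1 hs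
    obtain ⟨s₁, s₂, rfl, h3, h4⟩ := List.cons_sublist_iff.1 h2
    obtain ⟨t₁, t₂, rfl⟩ := List.append_of_mem h3
    rw [hr, show r₁ ++ (t₁ ++ f 1 :: t₂ ++ s₂) = (r₁ ++ t₁) ++ f 1 :: (t₂ ++ s₂) by simp] at h
    refine h.not_mem_of_lt (x := f 2) ?_ hlt ?_
    · simp [List.singleton_sublist.1 h4]
    · have := h1.subset (a := f 2) (by simp)
      simp [this]

/-! ### Concatenation and components -/

theorem stack_append_map {u v : List ℕ} {k : ℕ} (hu : ∀ x ∈ u, x ≤ k) (hv : ∀ x ∈ v, 1 ≤ x) :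
    stack (u ++ v.map (· + k)) = stack u ∪ (stack v).image (· + k) := by
  induction v using List.reverseRecOn with
  | nil => simp
  | append_singleton v z ih =>
    have hz : 1 ≤ z := hv z (by simp)
    rw [List.map_append, ← List.append_assoc, List.map_singleton, stack_concat, stack_concat,
      ih fun x hx => hv x (by simp [hx])]
    ext x
    have : x ∈ stack u → x < z + k := fun hx => by
      have := hu x (mem_of_mem_stack hx)
      omega
    simp only [Finset.mem_insert, Finset.mem_filter, Finset.mem_union, Finset.mem_image]
    constructor
    · rintro (rfl | ⟨h | ⟨a, ha, rfl⟩, h'⟩)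
      · exact Or.inr ⟨z, by simp, rfl⟩
      · exact Or.inl h
      · exact Or.inr ⟨a, Or.inr ⟨ha, by omega⟩, rfl⟩
    · rintro (h | ⟨a, rfl | ha, rfl⟩)
      · exact Or.inr ⟨Or.inl h, this h⟩
      · exact Or.inl rfl
      · exact Or.inr ⟨Or.inr ⟨a, ha.1, rfl⟩, by omega⟩

theorem isNC_append_map {u v : List ℕ} (hu : IsNC u) (hv : ∀ x ∈ v, 1 ≤ x) :
    IsNC (u ++ v.map (· + maxSymbol u)) ↔ IsNC v := by
  induction v using List.reverseRecOn with
  | nil => simpa using ⟨fun _ => .nil, fun _ => hu⟩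
  | append_singleton v z ih =>
    have hz : 1 ≤ z := hv z (by simp)
    have hv' : ∀ x ∈ v, 1 ≤ x := fun x hx => hv x (by simp [hx])
    rw [List.map_append, ← List.append_assoc, List.map_singleton, isNC_concat_iff,
      isNC_concat_iff, ih hv', nextSymbols, nextSymbols,
      stack_append_map (fun x => le_maxSymbol) hv', maxSymbol_append, maxSymbol_map_add]
    refine and_congr_right fun _ => ?_
    have : z + maxSymbol u ∉ stack u := fun h => by
      have := le_maxSymbol (mem_of_mem_stack h)
      omega
    simp only [Finset.mem_insert, Finset.mem_union, this, Finset.mem_image, false_or]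
    refine or_congr (by omega) ⟨?_, fun h => ⟨z, h, rfl⟩⟩
    rintro ⟨a, ha, h⟩
    obtain rfl : a = z := by omega
    exact ha

theorem card_stack_append_map {u v : List ℕ} (hv : ∀ x ∈ v, 1 ≤ x) :
    (stack (u ++ v.map (· + maxSymbol u))).card = (stack u).card + (stack v).card := by
  rw [stack_append_map (fun x => le_maxSymbol) hv, Finset.card_union_of_disjoint,
    Finset.card_image_of_injective _ (add_left_injective _)]
  rw [Finset.disjoint_left]
  intro x hx hx'
  obtain ⟨a, ha, rfl⟩ := Finset.mem_image.1 hx'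
  have := le_maxSymbol (mem_of_mem_stack hx)
  have := hv a (mem_of_mem_stack ha)
  omega

/-- A nonempty non-crossing word whose last symbol `x` is not `1` splits before the first
occurrence of `x`. -/
theorem exists_eq_append_map {w : List ℕ} {x : ℕ} (h : IsNC (w ++ [x])) :
    ∃ p t, IsNC p ∧ IsNC (1 :: t) ∧ maxSymbol p + 1 = x ∧
      w ++ [x] = p ++ (1 :: t).map (· + maxSymbol p) := by
  obtain ⟨p, q, hpq, hxp⟩ := List.eq_append_cons_of_mem (List.mem_append_right w (List.mem_singleton_self x))
  rw [hpq] at h ⊢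
  have hp : IsNC (p ++ [x]) := IsNC.of_append (v := q) (by simpa using h)
  have hpx := isNC_concat_iff.1 hp
  have hx : x = maxSymbol p + 1 := by
    rcases Finset.mem_insert.1 hpx.2 with hx | hx
    · exact hx
    · exact absurd (mem_of_mem_stack hx) hxp
  -- A symbol `y < x` of `q` would cross the block of `x`, as `w` ends with `x`.
  have hq : ∀ y ∈ x :: q, maxSymbol p + 1 ≤ y := by
    intro y hy
    rcases List.mem_cons.1 hy with rfl | hy
    · exact hx.ge
    by_contra hlt
    obtain ⟨q₁, q₂, rfl⟩ := List.append_of_mem hy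
    rw [show p ++ x :: (q₁ ++ y :: q₂) = (p ++ x :: q₁) ++ y :: q₂ by simp] at h hpq
    have hlast := congrArg List.getLast? hpq
    rw [List.getLast?_concat, List.getLast?_append_of_ne_nil _ (by simp)] at hlast
    rcases List.mem_cons.1 (List.mem_of_getLast? hlast.symm) with rfl | hxq
    · omega
    · exact h.not_mem_of_lt hxq (by omega) (by simp)
  have hmap : x :: q = (1 :: q.map (· - maxSymbol p)).map (· + maxSymbol p) := by
    rw [List.map_cons, List.map_map, hx, add_comm]
    congr 1
    conv_lhs => rw [← List.map_id q]
    refine List.map_congr_left fun y hy => ?_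
    have := hq y (by simp [hy])
    simp only [id, Function.comp]
    omega
  rw [hmap] at h ⊢
  refine ⟨p, _, hpx.1, (isNC_append_map hpx.1 fun y hy => ?_).1 h, hx.symm, rfl⟩
  rcases List.mem_cons.1 hy with rfl | hy
  · exact le_rfl
  · obtain ⟨a, ha, rfl⟩ := List.mem_map.1 hy
    have := hq a (by simp [ha])
    omega

theorem stack_concat_one {w : List ℕ} (h : IsRGF w) : stack (w ++ [1]) = {1} := by
  rw [stack_concat]
  ext x
  simp only [Finset.mem_insert, Finset.mem_filter, Finset.mem_singleton, or_iff_left_iff_imp]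
  intro hx
  have := h.mem_iff.1 (mem_of_mem_stack hx.1)
  omega

namespace SetPartition

theorem word_append (σ τ : SetPartition) :
    (σ.append τ).word = σ.word ++ τ.word.map (· + maxSymbol σ.word) := by
  rw [append, ← σ.isRGF.numSymbols_eq]

theorem nonCrossing_append {σ τ : SetPartition} :
    (σ.append τ).NonCrossing ↔ σ.NonCrossing ∧ τ.NonCrossing := by
  simp only [nonCrossing_iff, word_append]
  have hτ : ∀ x ∈ τ.word, 1 ≤ x := fun x hx => (τ.isRGF.mem_iff.1 hx).1
  constructor
  · intro h
    have h1 := h.of_append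
    exact ⟨h1, (isNC_append_map h1 hτ).1 h⟩
  · rintro ⟨h1, h2⟩
    exact (isNC_append_map h1 hτ).2 h2

theorem nonCrossing_empty : empty.NonCrossing :=
  (nonCrossing_iff _).2 .nil

theorem nonCrossing_concat {l : List SetPartition} :
    (concat l).NonCrossing ↔ ∀ σ ∈ l, σ.NonCrossing := by
  induction l with
  | nil => exact iff_of_true nonCrossing_empty (by simp)
  | cons σ l ih => rw [concat_cons, nonCrossing_append, ih]; simp

/-- The word of a nonempty connected non-crossing partition ends with `1`. -/
theorem Connected.exists_word_eq {σ : SetPartition} (hc : σ.Connected) (h0 : σ ≠ empty)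
    (h : σ.NonCrossing) : ∃ w, σ.word = w ++ [1] := by
  rw [nonCrossing_iff] at h
  rcases List.eq_nil_or_concat' σ.word with h1 | ⟨w, x, hw⟩
  · exact absurd (SetPartition.ext h1) h0
  · rw [hw] at h
    obtain ⟨p, t, hp, ht, hx, hpt⟩ := exists_eq_append_map h
    by_cases hx1 : x = 1
    · exact ⟨w, by rw [hw, hx1]⟩
    · refine absurd ⟨⟨p, hp.isRGF⟩, ⟨1 :: t, ht.isRGF⟩, ?_, ?_, ?_⟩ hc
      · intro he
        have : p = [] := congrArg word he
        simp [this, maxSymbol] at hx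
        omega
      · intro he
        exact List.cons_ne_nil _ _ (congrArg word he)
      · ext1
        rw [hw, hpt, word_append]

/-- The stack of a non-crossing word consists of the first symbols of its components. -/
theorem numComponents_eq {π : SetPartition} (h : π.NonCrossing) :
    π.numComponents = (stack π.word).card := by
  obtain ⟨hl, hπ⟩ := π.components_spec
  rw [numComponents]
  generalize π.components = l at *
  subst hπ
  induction l with
  | nil => rfl
  | cons σ l ih =>
    rw [concat_cons] at h ⊢
    have h2 := nonCrossing_append.1 h
    have hσ := hl σ (by simp)
    obtain ⟨w, hw⟩ := hσ.2.exists_word_eq hσ.1 h2.1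
    have hr := σ.isRGF
    rw [hw] at hr
    rw [word_append, card_stack_append_map
      fun x hx => ((concat l).isRGF.mem_iff.1 hx).1, ← ih (fun ρ hρ => hl ρ (by simp [hρ])) h2.2,
      hw, stack_concat_one hr.of_append]
    simp [add_comm]

end SetPartition

/-! ### Occurrences of a concatenated pattern -/

/-- The symbols of `w` larger than `M`, shifted down by `M`. -/
def upperPart (M : ℕ) (w : List ℕ) : List ℕ := (w.filter (M < ·)).map (· - M)

theorem map_add_upperPart (M : ℕ) (w : List ℕ) :
    (upperPart M w).map (· + M) = w.filter (M < ·) := by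
  rw [upperPart, List.map_map]
  conv_rhs => rw [← List.map_id (w.filter (M < ·))]
  refine List.map_congr_left fun x hx => ?_
  have := (List.mem_filter.1 hx).2
  simp only [decide_eq_true_eq, id, Function.comp] at this ⊢
  omega

theorem pos_of_mem_upperPart {M : ℕ} {w : List ℕ} {x : ℕ} (hx : x ∈ upperPart M w) : 1 ≤ x := by
  obtain ⟨a, ha, rfl⟩ := List.mem_map.1 hx
  have := (List.mem_filter.1 ha).2
  simp only [decide_eq_true_eq] at this
  omega

/-- `κ` contains `α`, but no proper prefix of `κ` does. -/
def MinOccurs (α κ : List ℕ) : Prop := Occurs α κ ∧ ¬ Occurs α κ.dropLast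

theorem Occurs.exists_minOccurs {α w : List ℕ} (h : Occurs α w) (hα : α ≠ []) :
    ∃ κ, κ <+: w ∧ MinOccurs α κ := by
  induction w using List.reverseRecOn with
  | nil =>
    obtain ⟨f, -, h⟩ := h
    simp [hα] at h
  | append_singleton w z ih =>
    by_cases hw : Occurs α w
    · obtain ⟨κ, hκ, hm⟩ := ih hw
      exact ⟨κ, hκ.trans (List.prefix_append _ _), hm⟩
    · exact ⟨w ++ [z], List.prefix_rfl, h, by simpa using hw⟩

theorem MinOccurs.eq_of_prefix {α κ₁ κ₂ : List ℕ} (h₁ : MinOccurs α κ₁) (h₂ : MinOccurs α κ₂)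
    (h : κ₁ <+: κ₂) : κ₁ = κ₂ := by
  rcases List.eq_nil_or_concat' κ₂ with rfl | ⟨u, z, rfl⟩
  · simpa using h
  · rcases List.prefix_concat_iff.1 h with h | h
    · exact h
    · exact absurd (h₁.1.mono h.sublist) (by simpa using h₂.2)

theorem MinOccurs.eq {α κ₁ κ₂ w : List ℕ} (h₁ : MinOccurs α κ₁) (h₂ : MinOccurs α κ₂)
    (hw₁ : κ₁ <+: w) (hw₂ : κ₂ <+: w) : κ₁ = κ₂ := by
  rcases List.prefix_or_prefix_of_prefix hw₁ hw₂ with h | h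
  · exact h₁.eq_of_prefix h₂ h
  · exact (h₂.eq_of_prefix h₁ h).symm

theorem MinOccurs.ne_nil {α κ : List ℕ} (h : MinOccurs α κ) : κ ≠ [] := by
  rintro rfl
  exact h.2 h.1

/-- An occurrence of `α` ends with its smallest symbol `b`. As `w` is non-crossing, every symbol
larger than `b` that follows this occurrence is new. So it does not matter which occurrence of `α`
is extended to one of `α[τ]`, and the one that ends first leaves most room. -/
theorem MinOccurs.occurs_append_iff {α τ κ w : List ℕ} (hw : IsNC w) (hα : ∀ x ∈ α, 1 ≤ x)
    (hα1 : ∃ u, α = u ++ [1]) (hτ : ∀ x ∈ τ, 1 ≤ x) (hκ : MinOccurs α κ) (hκw : κ <+: w) :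
    Occurs (α ++ τ.map (· + maxSymbol α)) w ↔ Occurs τ (upperPart (maxSymbol κ) w) := by
  set K := maxSymbol α with hK
  set M := maxSymbol κ with hM
  constructor
  · rintro ⟨f, hf, hs⟩
    obtain ⟨u, rfl⟩ := hα1
    have h1K : 1 ≤ K := le_maxSymbol (by simp)
    rw [List.map_append] at hs
    obtain ⟨r₁, r₂, rfl, h1, h2⟩ := List.append_sublist_iff.1 hs
    rw [List.map_append] at h1
    obtain ⟨t₁, t₂, rfl, h3, h4⟩ := List.append_sublist_iff.1 h1
    obtain ⟨t₃, t₄, rfl⟩ := List.append_of_mem (List.singleton_sublist.1 h4)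
    -- The occurrence of `α` ends in the displayed `f 1`, hence not inside `κ`.
    have hα' : Occurs (u ++ [1]) (t₁ ++ t₃ ++ [f 1]) := by
      refine ⟨f, hf.mono fun x hx => List.mem_append_left _ hx, ?_⟩
      rw [List.map_append]
      exact (h3.trans (List.sublist_append_left _ _)).append (List.Sublist.refl _)
    have hpre : t₁ ++ t₃ ++ [f 1] <+: t₁ ++ (t₃ ++ f 1 :: t₄) ++ r₂ := ⟨t₄ ++ r₂, by simp⟩
    have hle : M ≤ maxSymbol (t₁ ++ t₃ ++ [f 1]) := by
      have : κ <+: t₁ ++ t₃ ++ [f 1] := by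
        rcases List.prefix_or_prefix_of_prefix hκw hpre with h | h
        · exact h
        · rcases List.eq_nil_or_concat' κ with rfl | ⟨κ', a, rfl⟩
          · simp at h
          · rcases List.prefix_concat_iff.1 h with h | h
            · rw [h]
            · exact absurd (hα'.mono h.sublist) (by simpa using hκ.2)
      obtain ⟨s, hs⟩ := this
      rw [← hs, maxSymbol_append]
      exact le_max_left _ _
    have hlt : ∀ y ∈ τ, M < f (y + K) := by
      intro y hy
      refine hle.trans_lt (IsNC.maxSymbol_lt (q := t₄ ++ r₂) (by simpa using hw) ?_ ?_)
      · have : f (y + K) ∈ r₂ := h2.subset (by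
          rw [List.map_map]
          exact List.mem_map.2 ⟨y, hy, rfl⟩)
        simp [this]
      · refine hf (by simp) ?_ (by have := hτ y hy; omega)
        exact List.mem_append_right _ (List.mem_map.2 ⟨y, hy, rfl⟩)
    refine ⟨fun y => f (y + K) - M, ?_, ?_⟩
    · intro x hx y hy hxy
      have h5 := hlt x hx
      have h6 := hlt y hy
      have h7 : f (x + K) < f (y + K) :=
        hf (List.mem_append_right _ (List.mem_map.2 ⟨x, hx, rfl⟩))
          (List.mem_append_right _ (List.mem_map.2 ⟨y, hy, rfl⟩)) (by omega)
      show f (x + K) - M < f (y + K) - M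
      omega
    · have h5 : τ.map (fun y => f (y + K) - M) = upperPart M ((τ.map (· + K)).map f) := by
        rw [upperPart, List.filter_eq_self.2, List.map_map, List.map_map]
        · rfl
        · intro x hx
          simp only [List.mem_map, exists_exists_and_eq_and] at hx
          obtain ⟨y, hy, rfl⟩ := hx
          simpa using hlt y hy
      rw [h5]
      exact ((h2.trans (List.sublist_append_right _ _)).filter _).map _
  · rintro ⟨g, hg, hs⟩
    obtain ⟨f, hf, hfs⟩ := hκ.1
    obtain ⟨v, rfl⟩ := hκw
    have h1 : ∀ x ∈ α, f x ≤ M := fun x hx =>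
      le_maxSymbol (hfs.subset (List.mem_map.2 ⟨x, hx, rfl⟩))
    have h2 : ∀ x ∈ τ, 1 ≤ g x := fun x hx =>
      pos_of_mem_upperPart (hs.subset (List.mem_map.2 ⟨x, hx, rfl⟩))
    have hαK : ∀ x ∈ α, x ≤ K := fun x => le_maxSymbol
    refine ⟨fun x => if x ≤ K then f x else g (x - K) + M, ?_, ?_⟩
    · have hmem : ∀ x ∈ α ++ τ.map (· + K), (x ≤ K ∧ x ∈ α) ∨ (K < x ∧ x - K ∈ τ) := by
        intro x hx
        rcases List.mem_append.1 hx with hx | hx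
        · exact Or.inl ⟨hαK x hx, hx⟩
        · obtain ⟨y, hy, rfl⟩ := List.mem_map.1 hx
          have := hτ y hy
          exact Or.inr ⟨by omega, by simpa using hy⟩
      intro x hx y hy hxy
      rcases hmem x hx with ⟨hx1, hx2⟩ | ⟨hx1, hx2⟩ <;>
      rcases hmem y hy with ⟨hy1, hy2⟩ | ⟨hy1, hy2⟩
      · simpa [hx1, hy1] using hf hx2 hy2 hxy
      · have := h1 x hx2
        have := h2 _ hy2
        simp only [hx1, hy1.not_ge, if_true, if_false]
        omega
      · omega
      · have := hg hx2 hy2 (by omega)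
        simpa [hx1.not_ge, hy1.not_ge] using this
    · rw [List.map_append]
      refine List.Sublist.append ?_ ?_
      · rwa [List.map_congr_left fun x hx => if_pos (hαK x hx)]
      · have h3 := hs.map (· + M)
        rw [map_add_upperPart, List.filter_append, List.filter_eq_nil_iff.2, List.nil_append] at h3
        · rw [List.map_map] at h3 ⊢
          have h4 : τ.map ((fun x => if x ≤ K then f x else g (x - K) + M) ∘ fun x => x + K) =
              τ.map ((fun x => x + M) ∘ g) := by
            refine List.map_congr_left fun x hx => ?_
            have := hτ x hx
            simp [show ¬ x = 0 by omega]
          rw [h4]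
          exact h3.trans List.filter_sublist
        · intro x hx
          simpa using le_maxSymbol hx

/-! ### Counting the non-crossing extensions of a word -/

/-- The non-crossing words of length `n`. -/
def ncWords : ℕ → Finset (List ℕ)
  | 0 => {[]}
  | n + 1 => (ncWords n).biUnion fun w => (nextSymbols w).image (w ++ [·])

theorem mem_ncWords {n : ℕ} {w : List ℕ} : w ∈ ncWords n ↔ IsNC w ∧ w.length = n := by
  induction n generalizing w with
  | zero =>
    simp only [ncWords, Finset.mem_singleton, List.length_eq_zero_iff]
    exact ⟨fun h => ⟨h ▸ .nil, h⟩, fun h => h.2⟩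
  | succ n ih =>
    simp only [ncWords, Finset.mem_biUnion, Finset.mem_image, ih]
    constructor
    · rintro ⟨u, ⟨hu, rfl⟩, z, hz, rfl⟩
      exact ⟨hu.concat hz, by simp⟩
    · rintro ⟨h, hl⟩
      cases h with
      | nil => simp at hl
      | @concat u z h hz => exact ⟨u, ⟨h, by simpa using hl⟩, z, hz, rfl⟩

theorem card_filter_ncWords_succ (n : ℕ) (P : List ℕ → Prop) [DecidablePred P] :
    ((ncWords (n + 1)).filter P).card =
      ∑ w ∈ ncWords n, ((nextSymbols w).filter fun z => P (w ++ [z])).card := by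
  rw [ncWords, Finset.filter_biUnion, Finset.card_biUnion]
  · refine Finset.sum_congr rfl fun w _ => ?_
    rw [Finset.filter_image, Finset.card_image_of_injective]
    intro a b h
    simpa using h
  · intro u _ v _ huv
    rw [Function.onFun, Finset.disjoint_left]
    intro x hx hx'
    simp only [Finset.mem_filter, Finset.mem_image] at hx hx'
    obtain ⟨⟨a, -, rfl⟩, -⟩ := hx
    obtain ⟨⟨b, -, h⟩, -⟩ := hx'
    exact huv (List.append_inj' h rfl).1.symm

theorem upperPart_concat (M : ℕ) (w : List ℕ) (z : ℕ) :
    upperPart M (w ++ [z]) = upperPart M w ++ if M < z then [z - M] else [] := by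
  simp only [upperPart, List.filter_append, List.map_append]
  split_ifs with h <;> simp [h]

theorem upperPart_eq_nil {M : ℕ} {w : List ℕ} (h : maxSymbol w ≤ M) : upperPart M w = [] := by
  rw [upperPart, List.filter_eq_nil_iff.2, List.map_nil]
  intro x hx
  simpa using (le_maxSymbol hx).trans h

theorem maxSymbol_upperPart (M : ℕ) (w : List ℕ) :
    maxSymbol (upperPart M w) = maxSymbol w - M := by
  induction w using List.reverseRecOn with
  | nil => simp [upperPart, maxSymbol]
  | append_singleton w z ih =>
    rw [upperPart_concat, maxSymbol_append, maxSymbol_concat, ih]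
    split_ifs <;> simp [maxSymbol] <;> omega

/-- The large symbols in the stack of `w` form an upper segment of the stack of the upper part. -/
theorem exists_mem_stack_upperPart (M : ℕ) (w : List ℕ) :
    ∃ c, ∀ x, (x + M ∈ stack w ∧ 1 ≤ x) ↔ (x ∈ stack (upperPart M w) ∧ c ≤ x) := by
  induction w using List.reverseRecOn with
  | nil => exact ⟨0, by simp [upperPart]⟩
  | append_singleton w z ih =>
    obtain ⟨c, hc⟩ := ih
    rw [upperPart_concat]
    split_ifs with h
    · refine ⟨min c (z - M), fun x => ?_⟩
      rw [stack_concat, stack_concat]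
      have := hc x
      simp only [Finset.mem_insert, Finset.mem_filter]
      by_cases hx : x + M = z
      · simp [show x = z - M by omega]; omega
      · have h1 : ¬ x = z - M := by omega
        simp only [hx, h1, false_or]
        constructor
        · rintro ⟨⟨h2, h3⟩, h4⟩
          have := (hc x).1 ⟨h2, h4⟩
          exact ⟨⟨this.1, by omega⟩, by omega⟩
        · rintro ⟨⟨h2, h3⟩, h4⟩
          have := (hc x).2 ⟨h2, by omega⟩
          exact ⟨⟨this.1, by omega⟩, by omega⟩
    · refine ⟨maxSymbol (upperPart M w) + 1, fun x => ?_⟩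
      rw [List.append_nil]
      constructor
      · rintro ⟨h1, h2⟩
        simp only [stack_concat, Finset.mem_insert, Finset.mem_filter] at h1
        omega
      · rintro ⟨h1, h2⟩
        have := le_maxSymbol (mem_of_mem_stack h1)
        omega

theorem isNC_upperPart {w : List ℕ} (h : IsNC w) (M : ℕ) : IsNC (upperPart M w) := by
  induction h with
  | nil => exact .nil
  | @concat w z h hz ih =>
    rw [upperPart_concat]
    split_ifs with hMz
    · refine ih.concat ?_
      rcases Finset.mem_insert.1 hz with rfl | hz
      · refine Finset.mem_insert.2 (Or.inl ?_)
        rw [maxSymbol_upperPart]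
        omega
      · refine Finset.mem_insert_of_mem ?_
        obtain ⟨c, hc⟩ := exists_mem_stack_upperPart M w
        exact ((hc (z - M)).1 ⟨by rwa [Nat.sub_add_cancel hMz.le], by omega⟩).1
    · simpa using ih

/-- The number of symbols up to `M` in the stack of `w`. -/
def lowHeight (M : ℕ) (w : List ℕ) : ℕ := ((stack w).filter (· ≤ M)).card

/-- The number of symbols larger than `M` in the stack of `w`. -/
def highHeight (M : ℕ) (w : List ℕ) : ℕ := ((stack w).filter (M < ·)).card

theorem lowHeight_add_highHeight (M : ℕ) (w : List ℕ) :
    lowHeight M w + highHeight M w = (stack w).card := by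
  rw [lowHeight, highHeight, ← Finset.card_filter_add_card_filter_not (s := stack w) (· ≤ M)]
  simp only [not_le]

theorem lowHeight_concat_of_lt {M z : ℕ} (w : List ℕ) (h : M < z) :
    lowHeight M (w ++ [z]) = lowHeight M w := by
  rw [lowHeight, lowHeight, stack_concat, Finset.filter_insert, if_neg h.not_ge,
    Finset.filter_filter]
  congr 1
  ext x
  simp only [Finset.mem_filter]
  constructor
  · tauto
  · rintro ⟨h1, h2⟩; exact ⟨h1, by omega, h2⟩

theorem lowHeight_concat_of_le {M z : ℕ} (w : List ℕ) (h : z ≤ M) :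
    lowHeight M (w ++ [z]) = ((stack w).filter (· < z)).card + 1 := by
  rw [lowHeight, stack_concat, Finset.filter_true_of_mem, Finset.card_insert_of_notMem]
  · simp
  · intro x hx
    simp only [Finset.mem_insert, Finset.mem_filter] at hx
    omega

theorem highHeight_concat_of_le {M z : ℕ} (w : List ℕ) (h : z ≤ M) :
    highHeight M (w ++ [z]) = 0 := by
  rw [highHeight, stack_concat, Finset.card_eq_zero, Finset.filter_eq_empty_iff]
  intro x hx
  simp only [Finset.mem_insert, Finset.mem_filter] at hx
  omega

theorem highHeight_concat_of_lt {M z : ℕ} (w : List ℕ) (h : M < z) :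
    highHeight M (w ++ [z]) = ((stack w).filter fun x => M < x ∧ x < z).card + 1 := by
  rw [highHeight, stack_concat, Finset.filter_insert, if_pos h, Finset.card_insert_of_notMem,
    Finset.filter_filter]
  · congr 2
    ext x
    simp only [Finset.mem_filter]
    tauto
  · simp

/-- In a finite set of naturals, every rank below the cardinality is taken exactly once. -/
theorem card_filter_card_lt (T : Finset ℕ) (t : ℕ) :
    (T.filter fun z => (T.filter (· < z)).card = t).card = if t < T.card then 1 else 0 := by
  have hmono : ∀ x ∈ T, ∀ y ∈ T, x < y → (T.filter (· < x)).card < (T.filter (· < y)).card := by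
    intro x hx y hy hxy
    refine Finset.card_lt_card ⟨fun a ha => ?_, fun hs => ?_⟩
    · simp only [Finset.mem_filter] at ha ⊢
      exact ⟨ha.1, by omega⟩
    · simpa using hs (Finset.mem_filter.2 ⟨hx, hxy⟩)
  have hinj : Set.InjOn (fun z => (T.filter (· < z)).card) T := by
    intro x hx y hy hxy
    rcases lt_trichotomy x y with h | h | h
    · exact absurd hxy (hmono x hx y hy h).ne
    · exact h
    · exact absurd hxy (hmono y hy x hx h).ne'
  have hlt : ∀ x ∈ T, (T.filter (· < x)).card < T.card := by
    intro x hx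
    refine Finset.card_lt_card ⟨Finset.filter_subset _ _, fun hs => ?_⟩
    simpa using hs hx
  split_ifs with ht
  · have himg : T.image (fun z => (T.filter (· < z)).card) = Finset.range T.card := by
      refine Finset.eq_of_subset_of_card_le (fun a ha => ?_) ?_
      · obtain ⟨x, hx, rfl⟩ := Finset.mem_image.1 ha
        exact Finset.mem_range.2 (hlt x hx)
      · rw [Finset.card_image_of_injOn hinj, Finset.card_range]
    obtain ⟨z, hz, rfl⟩ := Finset.mem_image.1 (himg ▸ Finset.mem_range.2 ht)
    rw [Finset.card_eq_one]
    refine ⟨z, Finset.ext fun x => ?_⟩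
    simp only [Finset.mem_filter, Finset.mem_singleton]
    refine ⟨fun h => hinj h.1 hz h.2, ?_⟩
    rintro rfl
    exact ⟨hz, rfl⟩
  · rw [Finset.card_eq_zero, Finset.filter_eq_empty_iff]
    intro x hx h
    exact ht (h ▸ hlt x hx)

/-- Appending a symbol of the lower part: the new height determines the symbol. -/
theorem card_nextSymbols_low {M i C : ℕ} {w ρ : List ℕ} (hM : M ≤ maxSymbol w) (hi : i < C) :
    ((nextSymbols w).filter fun z => upperPart M (w ++ [z]) = ρ ∧
      lowHeight M (w ++ [z]) + i = C ∧ highHeight M (w ++ [z]) = 0).card =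
      if upperPart M w = ρ ∧ C ≤ lowHeight M w + i then 1 else 0 := by
  have key := card_filter_card_lt ((stack w).filter (· ≤ M)) (C - 1 - i)
  by_cases hρ : upperPart M w = ρ
  · have h1 : (if upperPart M w = ρ ∧ C ≤ lowHeight M w + i then 1 else 0) =
        if C - 1 - i < ((stack w).filter (· ≤ M)).card then 1 else 0 := by
      refine if_congr ?_ rfl rfl
      simp only [hρ, true_and, lowHeight]
      omega
    rw [h1, ← key]
    congr 1
    ext z
    simp only [Finset.mem_filter]
    by_cases hz : z ≤ M
    · have h2 : ((stack w).filter (· ≤ M)).filter (· < z) = (stack w).filter (· < z) := by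
        rw [Finset.filter_filter]
        refine Finset.filter_congr fun x _ => ?_
        omega
      rw [h2, upperPart_concat, if_neg hz.not_gt, List.append_nil, lowHeight_concat_of_le w hz,
        highHeight_concat_of_le w hz, nextSymbols, Finset.mem_insert]
      simp only [hρ, hz, true_and, and_true]
      have : z ≠ maxSymbol w + 1 := by omega
      simp only [this, false_or]
      refine and_congr_right fun _ => ?_
      omega
    · rw [highHeight_concat_of_lt w (not_le.1 hz)]
      simp [hz]
  · rw [if_neg (by tauto), Finset.card_eq_zero, Finset.filter_eq_empty_iff]
    rintro z - ⟨h1, -, h3⟩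
    by_cases hz : z ≤ M
    · rw [upperPart_concat, if_neg hz.not_gt, List.append_nil] at h1
      exact hρ h1
    · rw [highHeight_concat_of_lt w (not_le.1 hz)] at h3
      omega

/-- Appending a symbol of the upper part: the symbol is determined by the upper part, and it is
admissible if and only if the components of the upper part that were closed before stay closed. -/
theorem card_nextSymbols_high {M i C g y : ℕ} {w ρ : List ℕ} (hM : M ≤ maxSymbol w)
    (hρ : IsNC (ρ ++ [y])) (hg : g < (stack (ρ ++ [y])).card) :
    ((nextSymbols w).filter fun z => upperPart M (w ++ [z]) = ρ ++ [y] ∧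
      lowHeight M (w ++ [z]) + i = C ∧ highHeight M (w ++ [z]) + g = (stack (ρ ++ [y])).card).card =
      if upperPart M w = ρ ∧ lowHeight M w + i = C ∧ highHeight M w + g = (stack ρ).card
        then 1 else 0 := by
  have hy1 : 1 ≤ y := (hρ.isRGF.mem_iff.1 (by simp)).1
  have hyn := (isNC_concat_iff.1 hρ).2
  have hr : (stack (ρ ++ [y])).card = ((stack ρ).filter (· < y)).card + 1 := by
    rw [stack_concat, Finset.card_insert_of_notMem (by simp)]
  rw [hr] at hg ⊢
  have hcand : ∀ z, upperPart M (w ++ [z]) = ρ ++ [y] →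
      highHeight M (w ++ [z]) + g = ((stack ρ).filter (· < y)).card + 1 →
      upperPart M w = ρ ∧ z = y + M := by
    intro z h1 h2
    by_cases hz : M < z
    · rw [upperPart_concat, if_pos hz] at h1
      obtain ⟨h3, h4⟩ := List.append_inj' h1 rfl
      simp only [List.cons.injEq, and_true] at h4
      exact ⟨h3, by omega⟩
    · rw [highHeight_concat_of_le w (not_lt.1 hz)] at h2
      omega
  by_cases hu : upperPart M w = ρ
  swap
  · rw [if_neg (by tauto), Finset.card_eq_zero, Finset.filter_eq_empty_iff]
    rintro z - ⟨h1, -, h3⟩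
    exact hu (hcand z h1 h3).1
  subst hu
  obtain ⟨c, hc⟩ := exists_mem_stack_upperPart M w
  have hMy : M < y + M := by omega
  have hshift : ∀ (P : ℕ → Prop) [DecidablePred P],
      ((stack w).filter fun x => M < x ∧ P (x - M)).card =
        ((stack (upperPart M w)).filter fun x => c ≤ x ∧ P x).card := by
    intro P _
    symm
    refine Finset.card_bij (fun x _ => x + M) ?_ (fun a _ b _ h => by omega) ?_
    · intro x hx
      simp only [Finset.mem_filter] at hx ⊢
      have := (hc x).2 ⟨hx.1, hx.2.1⟩
      exact ⟨this.1, by omega, by simpa using hx.2.2⟩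
    · intro x hx
      simp only [Finset.mem_filter] at hx
      have := (hc (x - M)).1 ⟨by rw [Nat.sub_add_cancel hx.2.1.le]; exact hx.1, by omega⟩
      refine ⟨x - M, Finset.mem_filter.2 ⟨this.1, this.2, hx.2.2⟩, by omega⟩
  have hhigh : highHeight M w = ((stack (upperPart M w)).filter (c ≤ ·)).card := by
    simpa [highHeight] using hshift fun _ => True
  have hhigh' : highHeight M (w ++ [y + M]) =
      ((stack (upperPart M w)).filter fun x => c ≤ x ∧ x < y).card + 1 := by
    rw [highHeight_concat_of_lt w hMy, ← hshift (· < y)]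
    congr 2
    refine Finset.filter_congr fun x _ => ?_
    omega
  have hsplit : (stack (upperPart M w)).card = ((stack (upperPart M w)).filter (c ≤ ·)).card +
      ((stack (upperPart M w)).filter (· < c)).card := by
    rw [← Finset.card_filter_add_card_filter_not (s := stack (upperPart M w)) (c ≤ ·)]
    simp only [not_le]
  have hsplit' : ((stack (upperPart M w)).filter (· < y)).card =
      ((stack (upperPart M w)).filter fun x => c ≤ x ∧ x < y).card +
      ((stack (upperPart M w)).filter fun x => x < c ∧ x < y).card := by
    rw [← Finset.card_filter_add_card_filter_not
      (s := (stack (upperPart M w)).filter (· < y)) (c ≤ ·), Finset.filter_filter,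
      Finset.filter_filter]
    simp only [not_le, and_comm]
  have hmax := maxSymbol_upperPart M w
  have hmem : y + M ∈ nextSymbols w ↔ y = maxSymbol (upperPart M w) + 1 ∨ y + M ∈ stack w := by
    rw [nextSymbols, Finset.mem_insert, hmax]
    exact or_congr (by omega) Iff.rfl
  -- If `y` belongs to a component of `ρ` that is closed in `w`, then `y + M` cannot be appended, and
  -- in this case `g` is too small for the claimed height of `w`.
  have hcase : (y + M ∈ nextSymbols w ∧
      ((stack (upperPart M w)).filter fun x => x < c ∧ x < y) =
        (stack (upperPart M w)).filter (· < c)) ∨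
      (y + M ∉ nextSymbols w ∧ ((stack (upperPart M w)).filter (· < y)).card <
        ((stack (upperPart M w)).filter (· < c)).card) := by
    by_cases hcy : y + M ∈ nextSymbols w
    · refine Or.inl ⟨hcy, Finset.filter_congr fun x hx => and_iff_left_of_imp fun hxc => ?_⟩
      rcases hmem.1 hcy with h | h
      · have := le_maxSymbol (mem_of_mem_stack hx)
        omega
      · have := (hc y).1 ⟨h, hy1⟩
        omega
    · refine Or.inr ⟨hcy, Finset.card_lt_card ?_⟩
      rw [hmem, not_or] at hcy
      have hys : y ∈ stack (upperPart M w) := (Finset.mem_insert.1 hyn).resolve_left hcy.1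
      have hyc : y < c := by
        by_contra h
        exact hcy.2 ((hc y).2 ⟨hys, by omega⟩).1
      refine ⟨fun x hx => ?_, fun hs => ?_⟩
      · simp only [Finset.mem_filter] at hx ⊢
        exact ⟨hx.1, by omega⟩
      · simpa using hs (Finset.mem_filter.2 ⟨hys, hyc⟩)
  have hiff : (y + M ∈ nextSymbols w ∧ lowHeight M (w ++ [y + M]) + i = C ∧
      highHeight M (w ++ [y + M]) + g = ((stack (upperPart M w)).filter (· < y)).card + 1) ↔
      (lowHeight M w + i = C ∧ highHeight M w + g = (stack (upperPart M w)).card) := by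
    rw [hhigh, hhigh', lowHeight_concat_of_lt w hMy]
    rcases hcase with ⟨h1, h2⟩ | ⟨h1, h2⟩
    · rw [h2] at hsplit'
      simp only [h1, true_and]
      refine and_congr_right fun _ => ?_
      omega
    · simp only [h1, false_and, false_iff, not_and]
      omega
  simp only [true_and]
  rw [← if_congr hiff rfl rfl]
  split_ifs with h
  · rw [Finset.card_eq_one]
    refine ⟨y + M, Finset.ext fun z => ?_⟩
    rw [Finset.mem_filter, Finset.mem_singleton]
    refine ⟨fun hz => (hcand z hz.2.1 hz.2.2.2).2, ?_⟩
    rintro rfl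
    refine ⟨h.1, ?_, h.2⟩
    rw [upperPart_concat, if_pos hMy, Nat.add_sub_cancel]
  · rw [Finset.card_eq_zero, Finset.filter_eq_empty_iff]
    rintro z hz ⟨h1, h2⟩
    obtain rfl := (hcand z h1 h2.2).2
    exact h ⟨hz, h2⟩

theorem prefix_concat_iff_of_length_le {κ w : List ℕ} {z : ℕ} (h : κ.length ≤ w.length) :
    κ <+: w ++ [z] ↔ κ <+: w := by
  rw [List.prefix_concat_iff, or_iff_right]
  rintro rfl
  simp at h

theorem maxSymbol_le_of_prefix {κ w : List ℕ} (h : κ <+: w) : maxSymbol κ ≤ maxSymbol w := by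
  obtain ⟨v, rfl⟩ := h
  rw [maxSymbol_append]
  exact le_max_left _ _

theorem highHeight_le (M : ℕ) (w : List ℕ) : highHeight M w ≤ (stack (upperPart M w)).card := by
  obtain ⟨c, hc⟩ := exists_mem_stack_upperPart M w
  refine Finset.card_le_card_of_injOn (· - M) (fun x hx => ?_) (fun a ha b hb h => ?_)
  · simp only [Finset.coe_filter, Set.mem_ofPred_eq] at hx
    exact ((hc (x - M)).1 ⟨by rw [Nat.sub_add_cancel hx.2.le]; exact hx.1, by omega⟩).1
  · simp only [Finset.coe_filter, Set.mem_ofPred_eq] at ha hb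
    simp only at h
    omega

theorem lowHeight_maxSymbol (κ : List ℕ) : lowHeight (maxSymbol κ) κ = (stack κ).card := by
  rw [lowHeight, Finset.filter_true_of_mem fun x hx => le_maxSymbol (mem_of_mem_stack hx)]

theorem highHeight_maxSymbol (κ : List ℕ) : highHeight (maxSymbol κ) κ = 0 := by
  have := lowHeight_add_highHeight (maxSymbol κ) κ
  rw [lowHeight_maxSymbol] at this
  omega

theorem lowHeight_le_of_prefix {κ w : List ℕ} (hw : IsNC w) (h : κ <+: w) :
    lowHeight (maxSymbol κ) w ≤ (stack κ).card := by
  obtain ⟨v, rfl⟩ := h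
  induction v using List.reverseRecOn with
  | nil => rw [List.append_nil, lowHeight_maxSymbol]
  | append_singleton v z ih =>
    rw [← List.append_assoc] at hw ⊢
    have hn := isNC_concat_iff.1 hw
    refine le_trans ?_ (ih hn.1)
    by_cases hz : z ≤ maxSymbol κ
    · have hM : maxSymbol κ ≤ maxSymbol (κ ++ v) := maxSymbol_le_of_prefix (List.prefix_append _ _)
      have hzs : z ∈ stack (κ ++ v) := (Finset.mem_insert.1 hn.2).resolve_left (by omega)
      rw [lowHeight_concat_of_le _ hz]
      refine Finset.card_lt_card ⟨fun x hx => ?_, fun hs => ?_⟩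
      · simp only [Finset.mem_filter] at hx ⊢
        exact ⟨hx.1, by omega⟩
      · simpa using hs (Finset.mem_filter.2 ⟨hzs, hz⟩)
    · rw [lowHeight_concat_of_lt _ (not_le.1 hz)]

theorem IsNC.one_le_maxSymbol {w : List ℕ} (hw : IsNC w) (h0 : w ≠ []) : 1 ≤ maxSymbol w := by
  obtain ⟨a, ha⟩ := List.exists_mem_of_ne_nil w h0
  have := hw.isRGF.mem_iff.1 ha
  omega

theorem one_le_lowHeight {M : ℕ} {w : List ℕ} (hw : IsNC w) (h0 : w ≠ []) (hM : 1 ≤ M) :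
    1 ≤ lowHeight M w := by
  refine Finset.card_pos.2 ⟨1, Finset.mem_filter.2 ⟨mem_stack ?_ ?_, hM⟩⟩
  · exact hw.isRGF.mem_iff.2 ⟨le_rfl, hw.one_le_maxSymbol h0⟩
  · rintro p b q rfl -
    exact (hw.isRGF.mem_iff.1 (by simp : b ∈ p ++ b :: q)).1

theorem card_stack_pos {w : List ℕ} (hw : IsNC w) (h : w ≠ []) : 1 ≤ (stack w).card := by
  rw [← lowHeight_maxSymbol]
  exact one_le_lowHeight hw h (hw.one_le_maxSymbol h)

/-- Counts the non-crossing words that extend `κ` by `n` symbols, whose part of new symbols is `ρ`,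
and in which `i` components of `κ` and `g` components of `ρ` have been absorbed by components that
were continued later. Recording, after each old symbol of the extension, the two numbers of absorbed
components gives a chain in `ℕ × ℕ` that ends in `(i, g)`, and any chain arises exactly once. -/
theorem card_extensions {κ : List ℕ} (hκ : IsNC κ) {i : ℕ} (hi : i < (stack κ).card) (n : ℕ)
    {ρ : List ℕ} (hρ : IsNC ρ) {g : ℕ} (hg : g ≤ (stack ρ).card) :
    ((ncWords (κ.length + n)).filter fun w => κ <+: w ∧ upperPart (maxSymbol κ) w = ρ ∧
      lowHeight (maxSymbol κ) w + i = (stack κ).card ∧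
      highHeight (maxSymbol κ) w + g = (stack ρ).card).card =
      if ρ.length ≤ n then chainCount (n - ρ.length) i g else 0 := by
  induction n generalizing ρ i g with
  | zero =>
    have hfil : (ncWords (κ.length + 0)).filter (fun w => κ <+: w ∧
        upperPart (maxSymbol κ) w = ρ ∧ lowHeight (maxSymbol κ) w + i = (stack κ).card ∧
        highHeight (maxSymbol κ) w + g = (stack ρ).card) =
        ({κ} : Finset (List ℕ)).filter fun _ => ρ = [] ∧ i = 0 ∧ g = 0 := by
      ext w
      simp only [Finset.mem_filter, mem_ncWords, Finset.mem_singleton, add_zero]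
      constructor
      · rintro ⟨⟨_, hl⟩, hp, hu, h1, h2⟩
        obtain rfl := hp.eq_of_length hl.symm
        rw [upperPart_eq_nil le_rfl] at hu
        subst hu
        rw [lowHeight_maxSymbol] at h1
        simp only [stack_nil, Finset.card_empty] at h2
        exact ⟨rfl, rfl, by omega, by omega⟩
      · rintro ⟨rfl, rfl, rfl, rfl⟩
        simp [hκ, upperPart_eq_nil, lowHeight_maxSymbol, highHeight_maxSymbol]
    rw [hfil]
    by_cases h0 : ρ = []
    · subst h0
      by_cases h : i = 0 ∧ g = 0 <;> simp [chainCount, h, Finset.filter_singleton]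
    · have : ¬ ρ.length ≤ 0 := by simpa using h0
      simp [h0, this]
  | succ n ih =>
    rw [← add_assoc, card_filter_ncWords_succ]
    have hpre : ∀ w ∈ ncWords (κ.length + n), ∀ z, κ <+: w ++ [z] ↔ κ <+: w := by
      intro w hw z
      rw [mem_ncWords] at hw
      exact prefix_concat_iff_of_length_le (by omega)
    -- `g` is the number of all components of `ρ` exactly when the last symbol is an old one.
    by_cases hgr : g = (stack ρ).card
    · have hstep : ∀ w ∈ ncWords (κ.length + n), ((nextSymbols w).filter fun z =>
          κ <+: w ++ [z] ∧ upperPart (maxSymbol κ) (w ++ [z]) = ρ ∧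
          lowHeight (maxSymbol κ) (w ++ [z]) + i = (stack κ).card ∧
          highHeight (maxSymbol κ) (w ++ [z]) + g = (stack ρ).card).card =
          if κ <+: w ∧ upperPart (maxSymbol κ) w = ρ ∧
            (stack κ).card ≤ lowHeight (maxSymbol κ) w + i then 1 else 0 := by
        intro w hw
        simp only [hpre w hw, hgr, Nat.add_eq_right]
        by_cases hp : κ <+: w
        · simp only [hp, true_and]
          exact card_nextSymbols_low (maxSymbol_le_of_prefix hp) hi
        · simp [hp]
      rw [Finset.sum_congr rfl hstep, ← Finset.card_filter]
      have hmaps : Set.MapsTo (fun w => ((stack κ).card - lowHeight (maxSymbol κ) w,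
          (stack ρ).card - highHeight (maxSymbol κ) w))
          (↑((ncWords (κ.length + n)).filter fun w => κ <+: w ∧ upperPart (maxSymbol κ) w = ρ ∧
            (stack κ).card ≤ lowHeight (maxSymbol κ) w + i) : Set (List ℕ))
          (↑(Finset.range (i + 1) ×ˢ Finset.range (g + 1)) : Set (ℕ × ℕ)) := by
        intro w hw
        simp only [Finset.coe_filter, Set.mem_ofPred_eq] at hw
        simp only [Finset.coe_product, Set.mem_prod, Finset.mem_coe, Finset.mem_range]
        omega
      rw [Finset.card_eq_sum_card_fiberwise hmaps]
      have hfib : ∀ x ∈ Finset.range (i + 1) ×ˢ Finset.range (g + 1),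
          (((ncWords (κ.length + n)).filter fun w => κ <+: w ∧ upperPart (maxSymbol κ) w = ρ ∧
            (stack κ).card ≤ lowHeight (maxSymbol κ) w + i).filter fun w =>
            ((stack κ).card - lowHeight (maxSymbol κ) w,
              (stack ρ).card - highHeight (maxSymbol κ) w) = x).card =
          if ρ.length ≤ n then chainCount (n - ρ.length) x.1 x.2 else 0 := by
        rintro ⟨i', g'⟩ hx
        simp only [Finset.mem_product, Finset.mem_range] at hx
        rw [← ih (i := i') (by omega) hρ (g := g') (by omega), Finset.filter_filter]
        congr 1
        refine Finset.filter_congr fun w hw => ?_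
        rw [mem_ncWords] at hw
        simp only [Prod.mk.injEq, and_assoc]
        refine and_congr_right fun hp => and_congr_right fun hu => ?_
        have h1 := lowHeight_le_of_prefix hw.1 hp
        have h2 := highHeight_le (maxSymbol κ) w
        rw [hu] at h2
        omega
      rw [Finset.sum_congr rfl hfib, Finset.sum_product]
      by_cases hle : ρ.length ≤ n
      · rw [if_pos (by omega), Nat.succ_sub hle]
        simp [hle, chainCount]
      · simp only [hle, if_false, Finset.sum_const_zero]
        split_ifs with h
        · -- Here `ρ` is nonempty, so `g` is positive.
          have : ρ ≠ [] := by
            rintro rfl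
            simp at hle
          have hpos := card_stack_pos hρ this
          rw [show n + 1 - ρ.length = 0 by omega, chainCount, if_neg (by omega)]
        · rfl
    · rcases List.eq_nil_or_concat' ρ with rfl | ⟨ρ', y, rfl⟩
      · simp at hg hgr
        omega
      have hρ' := (isNC_concat_iff.1 hρ).1
      have hcard : (stack (ρ' ++ [y])).card ≤ (stack ρ').card + 1 := by
        rw [stack_concat]
        exact (Finset.card_insert_le _ _).trans
          (Nat.add_le_add_right (Finset.card_filter_le _ _) 1)
      have hstep : ∀ w ∈ ncWords (κ.length + n), ((nextSymbols w).filter fun z =>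
          κ <+: w ++ [z] ∧ upperPart (maxSymbol κ) (w ++ [z]) = ρ' ++ [y] ∧
          lowHeight (maxSymbol κ) (w ++ [z]) + i = (stack κ).card ∧
          highHeight (maxSymbol κ) (w ++ [z]) + g = (stack (ρ' ++ [y])).card).card =
          if κ <+: w ∧ upperPart (maxSymbol κ) w = ρ' ∧
            lowHeight (maxSymbol κ) w + i = (stack κ).card ∧
            highHeight (maxSymbol κ) w + g = (stack ρ').card then 1 else 0 := by
        intro w hw
        simp only [hpre w hw]
        by_cases hp : κ <+: w
        · simp only [hp, true_and]
          exact card_nextSymbols_high (maxSymbol_le_of_prefix hp) hρ (by omega)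
        · simp [hp]
      rw [Finset.sum_congr rfl hstep, ← Finset.card_filter, ih hi hρ' (by omega)]
      simp

/-! ### Generating polynomials of containing words -/

open Polynomial in
theorem stepPoly_eq_sum {n : ℕ} (hn : 1 ≤ n) (c : ℕ) :
    stepPoly n c = ∑ x ∈ Finset.range n ×ˢ Finset.range (c + 1),
      monomial (n - x.1 + (c - x.2)) (chainSeries x.1 x.2) := by
  obtain ⟨p, rfl⟩ := Nat.exists_eq_add_of_le' hn
  rw [stepPoly, chainPoly, Finset.mul_sum, Finset.sum_product]
  refine Finset.sum_congr rfl fun i hi => ?_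
  rw [Finset.mem_range] at hi
  rw [mul_comm, mul_assoc, Finset.sum_mul]
  refine Finset.sum_congr rfl fun g _ => ?_
  rw [← C_mul_X_pow_eq_monomial, mul_assoc, ← pow_succ, ← pow_add]
  congr 2
  omega

/-- The coefficients of `stepPoly` count the non-crossing extensions of `κ` with a given part of
new symbols. -/
theorem card_extensions_eq_coeff {κ : List ℕ} (hκ : IsNC κ) (h0 : κ ≠ []) (n m : ℕ) {ρ : List ℕ}
    (hρ : IsNC ρ) :
    (((ncWords (κ.length + n)).filter fun w => κ <+: w ∧ upperPart (maxSymbol κ) w = ρ ∧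
      (stack w).card = m).card : ℤ) =
      if ρ.length ≤ n then PowerSeries.coeff (n - ρ.length)
        ((stepPoly (stack κ).card (stack ρ).card).coeff m) else 0 := by
  have hC := card_stack_pos hκ h0
  have hM := hκ.one_le_maxSymbol h0
  have hlow : ∀ w ∈ ncWords (κ.length + n), κ <+: w → 1 ≤ lowHeight (maxSymbol κ) w := by
    intro w hw hp
    refine one_le_lowHeight (mem_ncWords.1 hw).1 ?_ hM
    rintro rfl
    exact h0 (List.prefix_nil.1 hp)
  have hmaps : Set.MapsTo (fun w => ((stack κ).card - lowHeight (maxSymbol κ) w,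
      (stack ρ).card - highHeight (maxSymbol κ) w))
      (↑((ncWords (κ.length + n)).filter fun w => κ <+: w ∧ upperPart (maxSymbol κ) w = ρ ∧
        (stack w).card = m) : Set (List ℕ))
      (↑(Finset.range (stack κ).card ×ˢ Finset.range ((stack ρ).card + 1)) : Set (ℕ × ℕ)) := by
    intro w hw
    simp only [Finset.coe_filter, Set.mem_ofPred_eq] at hw
    have := hlow w hw.1 hw.2.1
    simp only [Finset.coe_product, Set.mem_prod, Finset.mem_coe, Finset.mem_range]
    omega
  rw [Finset.card_eq_sum_card_fiberwise hmaps, stepPoly_eq_sum hC, Polynomial.finsetSum_coeff,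
    map_sum, Nat.cast_sum]
  have hfib : ∀ x ∈ Finset.range (stack κ).card ×ˢ Finset.range ((stack ρ).card + 1),
      (((ncWords (κ.length + n)).filter fun w => κ <+: w ∧ upperPart (maxSymbol κ) w = ρ ∧
        (stack w).card = m).filter fun w => ((stack κ).card - lowHeight (maxSymbol κ) w,
          (stack ρ).card - highHeight (maxSymbol κ) w) = x).card =
      if (stack κ).card - x.1 + ((stack ρ).card - x.2) = m then
        if ρ.length ≤ n then chainCount (n - ρ.length) x.1 x.2 else 0 else 0 := by
    rintro ⟨i, g⟩ hx
    simp only [Finset.mem_product, Finset.mem_range] at hx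
    have hequiv : ∀ w ∈ ncWords (κ.length + n),
        ((κ <+: w ∧ upperPart (maxSymbol κ) w = ρ ∧ (stack w).card = m) ∧
          ((stack κ).card - lowHeight (maxSymbol κ) w,
            (stack ρ).card - highHeight (maxSymbol κ) w) = (i, g)) ↔
        (stack κ).card - i + ((stack ρ).card - g) = m ∧ κ <+: w ∧
          upperPart (maxSymbol κ) w = ρ ∧ lowHeight (maxSymbol κ) w + i = (stack κ).card ∧
          highHeight (maxSymbol κ) w + g = (stack ρ).card := by
      intro w hw
      have h1 := lowHeight_add_highHeight (maxSymbol κ) w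
      have h2 := highHeight_le (maxSymbol κ) w
      rw [Prod.mk.injEq]
      constructor
      · rintro ⟨⟨hp, rfl, hm⟩, h3, h4⟩
        have h5 := lowHeight_le_of_prefix (mem_ncWords.1 hw).1 hp
        exact ⟨by omega, hp, rfl, by omega, by omega⟩
      · rintro ⟨h5, hp, rfl, h3, h4⟩
        exact ⟨⟨hp, rfl, by omega⟩, by omega, by omega⟩
    rw [Finset.filter_filter, Finset.filter_congr hequiv]
    split_ifs with hm hle
    · simp only [hm, true_and]
      rw [card_extensions hκ hx.1 n hρ (by omega), if_pos hle]
    · simp only [hm, true_and]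
      rw [card_extensions hκ hx.1 n hρ (by omega), if_neg hle]
    · simp [hm]
  rw [Finset.sum_congr rfl fun x hx => congrArg Nat.cast (hfib x hx)]
  simp only [Polynomial.coeff_monomial]
  split_ifs with hle
  · refine Finset.sum_congr rfl fun x _ => ?_
    split_ifs <;> simp [chainSeries]
  · simp

/-- The non-crossing words of length at most `N`. -/
def ncWordsUpTo (N : ℕ) : Finset (List ℕ) := (Finset.range (N + 1)).biUnion ncWords

theorem mem_ncWordsUpTo {N : ℕ} {w : List ℕ} :
    w ∈ ncWordsUpTo N ↔ IsNC w ∧ w.length ≤ N := by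
  simp [ncWordsUpTo, mem_ncWords, and_comm]

open scoped Classical in
/-- The generating polynomial of the non-crossing words of length at most `N` that contain `τ`:
the power series variable marks the length, the polynomial variable the number of components. -/
noncomputable def containGF (N : ℕ) (τ : List ℕ) : Polynomial (PowerSeries ℤ) :=
  ∑ ρ ∈ (ncWordsUpTo N).filter (Occurs τ),
    Polynomial.monomial (stack ρ).card (PowerSeries.X ^ ρ.length)

open scoped Classical in
theorem coeff_containGF {N n : ℕ} (hn : n ≤ N) (m : ℕ) (τ : List ℕ) :
    PowerSeries.coeff n ((containGF N τ).coeff m) =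
      ((ncWords n).filter fun w => Occurs τ w ∧ (stack w).card = m).card := by
  have h : (ncWords n).filter (fun w => Occurs τ w ∧ (stack w).card = m) =
      ((ncWordsUpTo N).filter (Occurs τ)).filter
        fun w => (stack w).card = m ∧ n = w.length := by
    ext w
    simp only [Finset.mem_filter, mem_ncWords, mem_ncWordsUpTo]
    constructor
    · rintro ⟨⟨h1, rfl⟩, h2, h3⟩
      exact ⟨⟨⟨h1, hn⟩, h2⟩, h3, rfl⟩
    · rintro ⟨⟨⟨h1, -⟩, h2⟩, h3, h4⟩
      exact ⟨⟨h1, h4.symm⟩, h2, h3⟩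
  rw [h, Finset.card_filter, containGF, Polynomial.finsetSum_coeff, map_sum, Nat.cast_sum]
  refine Finset.sum_congr rfl fun w _ => ?_
  rw [Polynomial.coeff_monomial]
  by_cases h1 : (stack w).card = m
  · by_cases h2 : n = w.length <;> simp [h1, h2, PowerSeries.coeff_X_pow]
  · simp [h1]

open scoped Classical in
/-- The operator that turns the generating polynomial of `τ` into that of `α[τ]`, up to order `N`;
see `coeff_containGF_append`. -/
noncomputable def prefixOp (N : ℕ) (α : List ℕ) :
    Module.End (PowerSeries ℤ) (Polynomial (PowerSeries ℤ)) :=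
  ∑ κ ∈ (ncWordsUpTo N).filter (MinOccurs α),
    (PowerSeries.X ^ κ.length : PowerSeries ℤ) • stepOp (stack κ).card

theorem prefixOp_commute (N : ℕ) (α β : List ℕ) : Commute (prefixOp N α) (prefixOp N β) :=
  Commute.sum_left _ _ _ fun _ _ => Commute.sum_right _ _ _ fun _ _ =>
    ((stepOp_commute _ _).smul_left _).smul_right _

open scoped Classical in
/-- A word containing `α[τ]` is an extension of its shortest prefix `κ` that contains `α`, and its
part `ρ` of symbols not in `κ` contains `τ`; the number of such extensions depends only on the
lengths and the numbers of components of `κ` and `ρ`. -/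
theorem coeff_containGF_append {N n : ℕ} (hn : n ≤ N) (m : ℕ) {α τ : List ℕ}
    (hα : ∀ x ∈ α, 1 ≤ x) (hα1 : ∃ u, α = u ++ [1]) (hτ : ∀ x ∈ τ, 1 ≤ x) :
    PowerSeries.coeff n ((containGF N (α ++ τ.map (· + maxSymbol α))).coeff m) =
      PowerSeries.coeff n ((prefixOp N α (containGF N τ)).coeff m) := by
  have hα0 : α ≠ [] := by
    obtain ⟨u, rfl⟩ := hα1
    simp
  have hdecomp : (ncWords n).filter (fun w => Occurs (α ++ τ.map (· + maxSymbol α)) w ∧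
      (stack w).card = m) =
      (((ncWordsUpTo N).filter (MinOccurs α)) ×ˢ ((ncWordsUpTo N).filter (Occurs τ))).biUnion
        fun x => (ncWords n).filter fun w => x.1 <+: w ∧ upperPart (maxSymbol x.1) w = x.2 ∧
          (stack w).card = m := by
    ext w
    simp only [Finset.mem_filter, Finset.mem_biUnion, Finset.mem_product, mem_ncWordsUpTo,
      mem_ncWords, Prod.exists]
    constructor
    · rintro ⟨⟨hw, rfl⟩, ho, hm⟩
      have ho' : Occurs α w := by
        obtain ⟨f, hf, hs⟩ := ho
        rw [List.map_append] at hs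
        exact ⟨f, hf.mono fun x hx => List.mem_append_left _ hx,
          (List.sublist_append_left _ _).trans hs⟩
      obtain ⟨κ, hκw, hκ⟩ := ho'.exists_minOccurs hα0
      refine ⟨κ, upperPart (maxSymbol κ) w, ⟨⟨⟨?_, hκw.length_le.trans hn⟩, hκ⟩,
        ⟨isNC_upperPart hw _, ?_⟩, (hκ.occurs_append_iff hw hα hα1 hτ hκw).1 ho⟩, ⟨hw, rfl⟩,
        hκw, rfl, hm⟩
      · obtain ⟨v, rfl⟩ := hκw
        exact hw.of_append
      · rw [upperPart, List.length_map]
        exact (List.length_filter_le _ _).trans hn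
    · rintro ⟨κ, ρ, ⟨⟨-, hκ⟩, -, ho⟩, ⟨hw, hl⟩, hκw, rfl, hm⟩
      exact ⟨⟨hw, hl⟩, (hκ.occurs_append_iff hw hα hα1 hτ hκw).2 ho, hm⟩
  rw [coeff_containGF hn, hdecomp, Finset.card_biUnion]
  · rw [Nat.cast_sum, Finset.sum_product, prefixOp, LinearMap.sum_apply,
      Polynomial.finsetSum_coeff, map_sum]
    refine Finset.sum_congr rfl fun κ hκ => ?_
    simp only [Finset.mem_filter, mem_ncWordsUpTo] at hκ
    rw [LinearMap.smul_apply, containGF, map_sum, Finset.smul_sum, Polynomial.finsetSum_coeff,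
      map_sum]
    refine Finset.sum_congr rfl fun ρ hρ => ?_
    simp only [Finset.mem_filter, mem_ncWordsUpTo] at hρ
    rw [stepOp_monomial, smul_smul, ← pow_add, Polynomial.coeff_smul, smul_eq_mul,
      PowerSeries.coeff_X_pow_mul']
    by_cases hle : κ.length ≤ n
    · have := card_extensions_eq_coeff hκ.1.1 hκ.2.ne_nil (n - κ.length) m hρ.1.1
      rw [Nat.add_sub_cancel' hle] at this
      rw [this, Nat.sub_sub]
      exact if_congr (by omega) rfl rfl
    · rw [if_neg (by omega), Nat.cast_eq_zero, Finset.card_eq_zero, Finset.filter_eq_empty_iff]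
      rintro w hw ⟨hp, -⟩
      have : κ.length ≤ w.length := hp.length_le
      rw [(mem_ncWords.1 hw).2] at this
      omega
  · rintro ⟨κ₁, ρ₁⟩ h₁ ⟨κ₂, ρ₂⟩ h₂ hne
    simp only [Finset.coe_product, Set.mem_prod, Finset.mem_coe, Finset.mem_filter] at h₁ h₂
    rw [Function.onFun, Finset.disjoint_left]
    intro w hw₁ hw₂
    simp only [Finset.mem_filter] at hw₁ hw₂
    refine hne ?_
    obtain rfl := h₁.1.2.eq h₂.1.2 hw₁.2.1 hw₂.2.1
    rw [← hw₁.2.2.1, ← hw₂.2.2.1]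

/-- Equality up to order `N` in the power series variable. -/
def TruncEq (N : ℕ) (F G : Polynomial (PowerSeries ℤ)) : Prop :=
  ∀ m, ∀ n ≤ N, PowerSeries.coeff n (F.coeff m) = PowerSeries.coeff n (G.coeff m)

theorem truncEq_iff {N : ℕ} {F G : Polynomial (PowerSeries ℤ)} :
    TruncEq N F G ↔ Polynomial.C (PowerSeries.X ^ (N + 1)) ∣ F - G := by
  simp only [TruncEq, Polynomial.C_dvd_iff_dvd_coeff, PowerSeries.X_pow_dvd_iff,
    Polynomial.coeff_sub, map_sub, sub_eq_zero, Nat.lt_succ_iff]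

theorem TruncEq.map {N : ℕ} {F G : Polynomial (PowerSeries ℤ)} (h : TruncEq N F G)
    (L : Module.End (PowerSeries ℤ) (Polynomial (PowerSeries ℤ))) : TruncEq N (L F) (L G) := by
  rw [truncEq_iff] at h ⊢
  obtain ⟨H, hH⟩ := h
  refine ⟨L H, ?_⟩
  rw [← map_sub, hH, ← Polynomial.smul_eq_C_mul, map_smul, Polynomial.smul_eq_C_mul]

theorem TruncEq.trans {N : ℕ} {F G H : Polynomial (PowerSeries ℤ)} (h₁ : TruncEq N F G)
    (h₂ : TruncEq N G H) : TruncEq N F H := fun m n hn => (h₁ m n hn).trans (h₂ m n hn)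

theorem TruncEq.symm {N : ℕ} {F G : Polynomial (PowerSeries ℤ)} (h : TruncEq N F G) :
    TruncEq N G F := fun m n hn => (h m n hn).symm

/-! ### Permuting the connected parts of a pattern -/

namespace SetPartition

theorem truncEq_append (N : ℕ) {σ : SetPartition} (h0 : σ ≠ empty) (hc : σ.Connected)
    (h : σ.NonCrossing) (τ : SetPartition) :
    TruncEq N (containGF N (σ.append τ).word) (prefixOp N σ.word (containGF N τ.word)) := by
  intro m n hn
  rw [word_append]
  exact coeff_containGF_append hn m (fun x hx => (σ.isRGF.mem_iff.1 hx).1)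
    (hc.exists_word_eq h0 h) fun x hx => (τ.isRGF.mem_iff.1 hx).1

/-- Up to order `N`, the generating polynomial of `σ₁[σ₂]⋯[σₖ]` with connected `σᵢ` arises from that
of the empty pattern by commuting operators, one for each `σᵢ`. -/
theorem truncEq_of_perm (N : ℕ) {l₁ l₂ : List SetPartition} (h : l₁.Perm l₂)
    (hl : ∀ σ ∈ l₁, σ ≠ empty ∧ σ.Connected ∧ σ.NonCrossing) :
    TruncEq N (containGF N (concat l₁).word) (containGF N (concat l₂).word) := by
  induction h with
  | nil => exact fun _ _ _ => rfl
  | cons σ _ ih =>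
    obtain ⟨h1, h2, h3⟩ := hl σ (by simp)
    rw [concat_cons, concat_cons]
    exact ((truncEq_append N h1 h2 h3 _).trans
      ((ih fun ρ hρ => hl ρ (by simp [hρ])).map _)).trans (truncEq_append N h1 h2 h3 _).symm
  | swap σ τ l =>
    obtain ⟨h1, h2, h3⟩ := hl σ (by simp)
    obtain ⟨h1', h2', h3'⟩ := hl τ (by simp)
    simp only [concat_cons]
    have e1 := (truncEq_append N h1' h2' h3' (σ.append (concat l))).trans
      ((truncEq_append N h1 h2 h3 (concat l)).map _)
    have e2 := (truncEq_append N h1 h2 h3 (τ.append (concat l))).trans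
      ((truncEq_append N h1' h2' h3' (concat l)).map _)
    rw [← Module.End.mul_apply] at e1 e2
    rw [(prefixOp_commute N σ.word τ.word).eq] at e2
    exact e1.trans e2.symm
  | trans h₁ _ ih₁ ih₂ =>
    exact (ih₁ hl).trans (ih₂ fun σ hσ => hl σ (h₁.mem_iff.2 hσ))

open scoped Classical in
/-- The avoiders of `σ` with given size and number of components, as words. -/
noncomputable def ncAvoidersFiberEquiv (σ : SetPartition) (c : ℕ × ℕ) :
    {π : ncAvoiders σ // ((π : SetPartition).size, (π : SetPartition).numComponents) = c} ≃
      {w // w ∈ (ncWords c.1).filter fun w => ¬ Occurs σ.word w ∧ (stack w).card = c.2} where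
  toFun π := ⟨π.1.1.word, by
    obtain ⟨⟨π, hπ⟩, rfl⟩ := π
    rw [Finset.mem_filter, mem_ncWords, ← nonCrossing_iff, ← contains_iff]
    exact ⟨⟨hπ.1, rfl⟩, hπ.2, (numComponents_eq hπ.1).symm⟩⟩
  invFun w := by
    have hw := w.2
    rw [Finset.mem_filter, mem_ncWords] at hw
    have hnc : NonCrossing ⟨w.1, hw.1.1.isRGF⟩ := (nonCrossing_iff _).2 hw.1.1
    exact ⟨⟨⟨w.1, hw.1.1.isRGF⟩, hnc, fun h => hw.2.1 ((contains_iff _ _).1 h)⟩,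
      Prod.ext hw.1.2 ((numComponents_eq hnc).trans hw.2.2)⟩
  left_inv _ := rfl
  right_inv _ := rfl

theorem ccEquiv_of_truncEq {σ τ : SetPartition} (hσ : σ.NonCrossing) (hτ : τ.NonCrossing)
    (h : ∀ N, TruncEq N (containGF N σ.word) (containGF N τ.word)) : CCEquiv σ τ := by
  classical
  refine ⟨hσ, hτ, ?_⟩
  have hcard : ∀ c : ℕ × ℕ,
      ((ncWords c.1).filter fun w => ¬ Occurs σ.word w ∧ (stack w).card = c.2).card =
      ((ncWords c.1).filter fun w => ¬ Occurs τ.word w ∧ (stack w).card = c.2).card := by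
    intro c
    have h1 := h c.1 c.2 c.1 le_rfl
    rw [coeff_containGF le_rfl, coeff_containGF le_rfl, Nat.cast_inj] at h1
    have h2 : ∀ u : List ℕ, ((ncWords c.1).filter fun w => Occurs u w ∧ (stack w).card = c.2).card +
        ((ncWords c.1).filter fun w => ¬ Occurs u w ∧ (stack w).card = c.2).card =
        ((ncWords c.1).filter fun w => (stack w).card = c.2).card := by
      intro u
      rw [← Finset.card_filter_add_card_filter_not
        (s := (ncWords c.1).filter fun w => (stack w).card = c.2) (Occurs u),
        Finset.filter_filter, Finset.filter_filter]
      simp only [and_comm]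
    have := h2 σ.word
    have := h2 τ.word
    omega
  let e : ncAvoiders σ ≃ ncAvoiders τ := Equiv.ofFiberEquiv
    (f := fun π : ncAvoiders σ => ((π : SetPartition).size, (π : SetPartition).numComponents))
    (g := fun π : ncAvoiders τ => ((π : SetPartition).size, (π : SetPartition).numComponents))
    fun c => (ncAvoidersFiberEquiv σ c).trans
      ((Finset.equivOfCardEq (hcard c)).trans (ncAvoidersFiberEquiv τ c).symm)
  refine ⟨e, e.bijective, fun π => ?_⟩
  exact Prod.ext_iff.1 (Equiv.ofFiberEquiv_map
    (f := fun π : ncAvoiders σ => ((π : SetPartition).size, (π : SetPartition).numComponents))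
    (g := fun π : ncAvoiders τ => ((π : SetPartition).size, (π : SetPartition).numComponents)) _ π)

theorem concat_flatMap_components (l : List SetPartition) :
    concat (l.flatMap components) = concat l := by
  induction l with
  | nil => rfl
  | cons σ l ih =>
    rw [List.flatMap_cons, concat_append, concat_cons, ih, σ.components_spec.2]

theorem ccEquiv_of_perm {l₁ l₂ : List SetPartition} (h : l₁.Perm l₂)
    (hl : ∀ σ ∈ l₁, σ.NonCrossing) : CCEquiv (concat l₁) (concat l₂) := by
  refine ccEquiv_of_truncEq (nonCrossing_concat.2 hl)
    (nonCrossing_concat.2 fun σ hσ => hl σ (h.mem_iff.2 hσ)) fun N => ?_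
  rw [← concat_flatMap_components l₁, ← concat_flatMap_components l₂]
  refine truncEq_of_perm N (h.flatMap_right _) fun σ hσ => ?_
  obtain ⟨ρ, hρ, hσ⟩ := List.mem_flatMap.1 hσ
  have hc := ρ.components_spec
  have hnc := hl ρ hρ
  rw [← hc.2, nonCrossing_concat] at hnc
  exact ⟨(hc.1 σ hσ).1, (hc.1 σ hσ).2, hnc σ hσ⟩

end SetPartition
end NCPattern

theorem mainTheorem6 (k : ℕ) (σ : Fin k → NCPattern.SetPartition)
    (hσ : ∀ i, (σ i).NonCrossing) (p : Equiv.Perm (Fin k)) :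
    NCPattern.SetPartition.CCEquiv
      (NCPattern.SetPartition.concat (List.ofFn fun i => σ i))
      (NCPattern.SetPartition.concat (List.ofFn fun i => σ (p i))) := by
  refine NCPattern.SetPartition.ccEquiv_of_perm (p.ofFn_comp_perm σ).symm fun τ hτ => ?_
  obtain ⟨i, rfl⟩ := List.mem_ofFn.1 hτ
  exact hσ i
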